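/- **Theorem (cut-free Henkin completeness).** Let $\Gamma,\Phi_1,\dots,\Phi_n\vdash\Delta$ be a canonical sequent of the logic FO(ID) such that no negation occurs in the body of any definitional rule of any $\Phi_i$. If $\Gamma,\Phi_1,\dots,\Phi_n\vdash\Delta$ is valid under the Henkin semantics, then it has an $\mathrm{SC}_{\mathrm{FO(ID)}}$-proof that does not use the rule (cut). The notions are the following. *Syntax.* Fix infinitely many object symbols (which may be free or quantified), function symbols and predicate symbols. First-order formulas are built from $\top$, $\bot$, $t=s$ and $P(\bar t)$ by $\neg,\wedge,\vee,\Rightarrow,\Leftrightarrow,\forall,\exists$. A *definition* $\Phi$ is a finite set of definitional rules $\forall\bar x: P(\bar t)\leftarrow\varphi$ with head $P(\bar t)$ and a first-order formula $\varphi$ as body; $\mathrm{Def}(\Phi)$ is the set of predicates occurring in heads, and $\mathrm{Par}(\Phi)$ the set of the other symbols that occur freely in $\Phi$. FO(ID)-formulas are built like first-order formulas, with definitions as additional atomic formulas. Formulas and rules are identified up to renaming of bound object symbols. A sequent $\Gamma\vdash\Delta$ consists of two sets of FO(ID)-formulas. An occurrence of a predicate is positive (negative) if it is in the scope of an even (odd)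 number of negations, where $\Rightarrow$ and $\Leftrightarrow$ are first rewritten by $\neg,\wedge,\vee$. *Canonical sequents.* $\Gamma,\Phi_1,\dots,\Phi_n\vdash\Delta$ is canonical if $\Gamma$ and $\Delta$ are finite sets of first-order formulas, $\Phi_1,\dots,\Phi_n$ are definitions, every rule body of every $\Phi_i$ is composed of literals (atoms and negated atoms) by conjunctions and disjunctions, $\mathrm{Def}(\Phi_i)\cap\mathrm{Def}(\Phi_j)=\emptyset$ for $i\ne j$, and $\mathrm{Def}(\Phi_i)\cap\mathrm{Par}(\Phi_j)=\emptyset$ for $j<i$. *Henkin semantics.* Let $I$ be a first-order structure with nonempty domain $D$, which interprets all function, predicate and object symbols. A *Henkin class* for $I$ is a family $\mathcal H=(H_k)_{k\in\mathbb N}$ with $H_k\subseteq\mathcal P(D^k)$ such that (i) $\{(a,a)\mid a\in D\}\in H_2$; (ii) $Q^I\in H_k$ for every $k$-ary predicate symbol $Q$; (iii) if $R\in H_{k+1}$ and $a\in D$, then $\{\bar a\in D^k\mid(\bar a,a)\in R\}\in H_k$; (iv) if $R\in H_k$, $\bar t=(t_1,\dots,t_k)$ are terms, $x_1,\dots,x_n,y_1,\dots,y_m$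 are distinct object symbols and $\bar b\in D^m$, then $\{\bar a\in D^n\mid \bar t^{\,I[\bar x:\bar a,\bar y:\bar b]}\in R\}\in H_n$; (v) if $R\in H_k$, then $D^k\setminus R\in H_k$; (vi) if $R,S\in H_k$, then $R\cap S\in H_k$; (vii) if $R\in H_{k+1}$, then $\{\bar a\in D^k\mid(\bar a,a)\in R\text{ for all }a\in D\}\in H_k$. For a definition $\Phi$, let $\mathcal S$ be the set of structures $J$ that differ from $I$ at most in the values of the predicates in $\mathrm{Def}(\Phi)$. For $J\in\mathcal S$ let $\mathcal C(J,I)\in\mathcal S$ be the structure in which the value of $P\in\mathrm{Def}(\Phi)$ consists of the tuples $\bar a$ such that, for some rule $\forall\bar x:P(\bar t)\leftarrow\varphi$ of $\Phi$ and some values of $\bar x$ in $D$, $\bar t$ has the value $\bar a$ and $\varphi$ is true when positive occurrences of predicates in $\varphi$ are interpreted by $J$ and negative ones by $I$. Then $(I,\mathcal H)$ is a *Henkin model* of $\Phi$ if $I$ is the least, for inclusion of the values of the predicates in $\mathrm{Def}(\Phi)$, among the $J\in\mathcal S$ such that $P^J\in\mathcal H$ and $P^{\mathcal C(J,I)}\subseteq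 P^J$ for all $P\in\mathrm{Def}(\Phi)$. Satisfaction of FO(ID)-formulas in $(I,\mathcal H)$ is defined by the usual clauses, and $\Phi$ is satisfied if $(I,\mathcal H)$ is a Henkin model of $\Phi$. A sequent is *valid under the Henkin semantics* if every $(I,\mathcal H)$ that satisfies all formulas on its left-hand side satisfies some formula on its right-hand side. *The calculus* $\mathrm{SC}_{\mathrm{FO(ID)}}$. Write $\Gamma,\varphi$ for $\Gamma\cup\{\varphi\}$. Its rules are: - the axioms $\Gamma\vdash\Delta$ with $\Gamma\cap\Delta\neq\emptyset$, $\bot\in\Gamma$ or $\top\in\Delta$; - weakening: from $\Gamma'\vdash\Delta'$ infer $\Gamma\vdash\Delta$, if $\Gamma'\subseteq\Gamma$ and $\Delta'\subseteq\Delta$; - substitution: from $\Gamma\vdash\Delta$ infer $\Gamma[t/x]\vdash\Delta[t/x]$; - (cut): from $\Gamma\vdash\varphi,\Delta$ and $\Gamma,\varphi\vdash\Delta$ infer $\Gamma\vdash\Delta$; - the usual left and right rules of Gentzen's LK for $\neg,\wedge,\vee,\Rightarrow,\Leftrightarrow,\forall,\exists$ (in the right rule for $\forall$ and the left rule for $\exists$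 the eigenvariable does not occur freely in the conclusion); - ($=$L): from $\Gamma[s/x,t/y]\vdash\Delta[s/x,t/y]$ infer $\Gamma[t/x,s/y],t=s\vdash\Delta[t/x,s/y]$; and the axioms ($=$R): $\Gamma\vdash t=t,\Delta$; - (def R): from $\Gamma,\Phi\vdash\varphi[\bar s/\bar x],\Delta$ infer $\Gamma,\Phi\vdash P(\bar t[\bar s/\bar x]),\Delta$, where $\Phi$ is a definition with a rule $\forall\bar x:P(\bar t)\leftarrow\varphi$ and $\bar s$ is a tuple of terms; - (def L): choose a definition $\Phi$, a set $\Pi\subseteq\mathrm{Def}(\Phi)$, a predicate $P\in\Pi$, and for every $Q\in\Pi$ a first-order formula $F_Q[\bar z]$ (the induction hypothesis) with a distinguished tuple $\bar z$ of distinct object symbols of the arity of $Q$. From the major premise $\Gamma,\Phi,F_P[\bar v]\vdash\Delta$ and the minor premises $\Gamma,\Phi,\psi[F_\Pi/\Pi^+]\vdash F_Q[\bar s],\Delta$, one for every rule $\forall\bar y:Q(\bar s)\leftarrow\psi$ of $\Phi$ with $Q\in\Pi$, infer $\Gamma,\Phi,P(\bar v)\vdash\Delta$. Here $\psi[F_\Pi/\Pi^+]$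 arises from $\psi$ by replacing every positive occurrence of an atom $R(\bar u)$ with $R\in\Pi$ by $F_R[\bar u]$, and the object symbols in $\bar y$ are distinct and (after renaming) occur freely neither in $\Gamma$, $\Delta$ or $\Phi$ nor, except for $\bar z$, in the induction hypotheses. -/

import Mathlib

universe u v w

namespace FOID

/-! ### Syntax

Object symbols are the elements of a type `Obj`; they can be quantified and substituted.
All other function symbols, and the predicate symbols, come from a first-order language `L`.
(Elements of `L.Functions 0`, if there are any, are additional constants.)
Formulas are taken up to renaming of bound object symbols: an object symbol that is bound is
written as an index in `Fin n`, and `Form L Obj n` is the type of formulas in which `n` bound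
object symbols are still open. Ordinary formulas are the elements of `Form L Obj 0`. -/

/-- Predicate symbols, bundled with their arity. -/
abbrev Pred (L : FirstOrder.Language.{u, v}) : Type v := Σ k : ℕ, L.Relations k

/-- Terms with free object symbols in `Obj` and `n` open bound object symbols. -/
abbrev Tm (L : FirstOrder.Language.{u, v}) (Obj : Type w) (n : ℕ) : Type (max u w) :=
  L.Term (Obj ⊕ Fin n)

/-- First-order formulas. -/
inductive Form (L : FirstOrder.Language.{u, v}) (Obj : Type w) : ℕ → Type (max u v w)
  | top {n : ℕ} : Form L Obj n
  | bot {n : ℕ} : Form L Obj n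
  | eq {n : ℕ} (t s : Tm L Obj n) : Form L Obj n
  | rel {n : ℕ} (P : Pred L) (ts : Fin P.1 → Tm L Obj n) : Form L Obj n
  | neg {n : ℕ} (φ : Form L Obj n) : Form L Obj n
  | and {n : ℕ} (φ ψ : Form L Obj n) : Form L Obj n
  | or {n : ℕ} (φ ψ : Form L Obj n) : Form L Obj n
  | imp {n : ℕ} (φ ψ : Form L Obj n) : Form L Obj n
  | iff {n : ℕ} (φ ψ : Form L Obj n) : Form L Obj n
  | all {n : ℕ} (φ : Form L Obj (n + 1)) : Form L Obj n
  | ex {n : ℕ} (φ : Form L Obj (n + 1)) : Form L Obj n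

/-- A definitional rule `∀ x̄ : P(t̄) ← φ`, where `x̄` is a tuple of `k` object symbols. -/
structure Rule (L : FirstOrder.Language.{u, v}) (Obj : Type w) (n : ℕ) :
    Type (max u v w) where
  k : ℕ
  head : Pred L
  args : Fin head.1 → Tm L Obj (n + k)
  body : Form L Obj (n + k)

/-- A definition is a finite set of definitional rules. -/
structure Defn (L : FirstOrder.Language.{u, v}) (Obj : Type w) (n : ℕ) :
    Type (max u v w) where
  rules : Set (Rule L Obj n)
  finite : rules.Finite

/-- Formulas of FO(ID): atoms and definitions, closed under connectives and quantifiers. -/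
inductive IDForm (L : FirstOrder.Language.{u, v}) (Obj : Type w) : ℕ → Type (max u v w)
  | top {n : ℕ} : IDForm L Obj n
  | bot {n : ℕ} : IDForm L Obj n
  | eq {n : ℕ} (t s : Tm L Obj n) : IDForm L Obj n
  | rel {n : ℕ} (P : Pred L) (ts : Fin P.1 → Tm L Obj n) : IDForm L Obj n
  | defn {n : ℕ} (Φ : Defn L Obj n) : IDForm L Obj n
  | neg {n : ℕ} (φ : IDForm L Obj n) : IDForm L Obj n
  | and {n : ℕ} (φ ψ : IDForm L Obj n) : IDForm L Obj n
  | or {n : ℕ} (φ ψ : IDForm L Obj n) : IDForm L Obj n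
  | imp {n : ℕ} (φ ψ : IDForm L Obj n) : IDForm L Obj n
  | iff {n : ℕ} (φ ψ : IDForm L Obj n) : IDForm L Obj n
  | all {n : ℕ} (φ : IDForm L Obj (n + 1)) : IDForm L Obj n
  | ex {n : ℕ} (φ : IDForm L Obj (n + 1)) : IDForm L Obj n

variable {L : FirstOrder.Language.{u, v}} {Obj : Type w}

/-- Every first-order formula is a formula of FO(ID). -/
def Form.toID : {n : ℕ} → Form L Obj n → IDForm L Obj n
  | _, .top => .top
  | _, .bot => .bot
  | _, .eq t s => .eq t s
  | _, .rel P ts => .rel P ts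
  | _, .neg φ => .neg φ.toID
  | _, .and φ ψ => .and φ.toID ψ.toID
  | _, .or φ ψ => .or φ.toID ψ.toID
  | _, .imp φ ψ => .imp φ.toID ψ.toID
  | _, .iff φ ψ => .iff φ.toID ψ.toID
  | _, .all φ => .all φ.toID
  | _, .ex φ => .ex φ.toID

/-! ### Defined predicates, parameters, free object symbols -/

/-- The predicate symbols that occur in a formula. -/
def Form.preds : {n : ℕ} → Form L Obj n → Set (Pred L)
  | _, .top => ∅
  | _, .bot => ∅
  | _, .eq _ _ => ∅
  | _, .rel P _ => {P}
  | _, .neg φ => φ.preds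
  | _, .and φ ψ => φ.preds ∪ ψ.preds
  | _, .or φ ψ => φ.preds ∪ ψ.preds
  | _, .imp φ ψ => φ.preds ∪ ψ.preds
  | _, .iff φ ψ => φ.preds ∪ ψ.preds
  | _, .all φ => φ.preds
  | _, .ex φ => φ.preds

/-- The defined predicates of a definition. -/
def Defn.defined {n : ℕ} (Φ : Defn L Obj n) : Set (Pred L) :=
  {P | ∃ r ∈ Φ.rules, r.head = P}

/-- The predicate symbols among the parameters of a definition. -/
def Defn.params {n : ℕ} (Φ : Defn L Obj n) : Set (Pred L) :=
  {P | (∃ r ∈ Φ.rules, P ∈ r.body.preds) ∧ P ∉ Φ.defined}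

/-- The free object symbols of a term. -/
def Tm.free {n : ℕ} : Tm L Obj n → Set Obj
  | .var (.inl o) => {o}
  | .var (.inr _) => ∅
  | .func _ ts => ⋃ i, Tm.free (ts i)

/-- The object symbols that occur freely in a first-order formula. -/
def Form.free : {n : ℕ} → Form L Obj n → Set Obj
  | _, .top => ∅
  | _, .bot => ∅
  | _, .eq t s => Tm.free t ∪ Tm.free s
  | _, .rel _ ts => ⋃ i, Tm.free (ts i)
  | _, .neg φ => φ.free
  | _, .and φ ψ => φ.free ∪ ψ.free
  | _, .or φ ψ => φ.free ∪ ψ.free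
  | _, .imp φ ψ => φ.free ∪ ψ.free
  | _, .iff φ ψ => φ.free ∪ ψ.free
  | _, .all φ => φ.free
  | _, .ex φ => φ.free

/-- The object symbols that occur freely in a definition. -/
def Defn.free {n : ℕ} (Φ : Defn L Obj n) : Set Obj :=
  {o | ∃ r ∈ Φ.rules, (∃ i, o ∈ Tm.free (r.args i)) ∨ o ∈ r.body.free}

/-- The object symbols that occur freely in a formula of FO(ID). -/
def IDForm.free : {n : ℕ} → IDForm L Obj n → Set Obj
  | _, .top => ∅
  | _, .bot => ∅
  | _, .eq t s => Tm.free t ∪ Tm.free s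
  | _, .rel _ ts => ⋃ i, Tm.free (ts i)
  | _, .defn Φ => Φ.free
  | _, .neg φ => φ.free
  | _, .and φ ψ => φ.free ∪ ψ.free
  | _, .or φ ψ => φ.free ∪ ψ.free
  | _, .imp φ ψ => φ.free ∪ ψ.free
  | _, .iff φ ψ => φ.free ∪ ψ.free
  | _, .all φ => φ.free
  | _, .ex φ => φ.free

/-- The object symbols that occur freely in some formula of a set. -/
def freeIn (Γ : Set (IDForm L Obj 0)) : Set Obj := ⋃ φ ∈ Γ, φ.free

/-! ### Substitution -/

/-- A simultaneous substitution of terms for free object symbols and open bound ones. -/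
abbrev Subst (L : FirstOrder.Language.{u, v}) (Obj : Type w) (n m : ℕ) : Type (max u w) :=
  Obj ⊕ Fin n → Tm L Obj m

/-- The substitution acting below a quantification over `k` further object symbols. -/
def Subst.lift {n m : ℕ} (k : ℕ) (σ : Subst L Obj n m) : Subst L Obj (n + k) (m + k)
  | .inl o => (σ (.inl o)).relabel (Sum.map id (Fin.castAdd k))
  | .inr i =>
      Fin.addCases (motive := fun _ => Tm L Obj (m + k))
        (fun j => (σ (.inr j)).relabel (Sum.map id (Fin.castAdd k)))
        (fun j => .var (.inr (Fin.natAdd m j))) i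

/-- The substitution that replaces the open bound object symbols by the terms `ts`. -/
def Subst.fill {n m : ℕ} (ts : Fin n → Tm L Obj m) : Subst L Obj n m :=
  Sum.elim (fun o => .var (.inl o)) ts

/-- The substitution that replaces free object symbols according to `τ`. -/
def Subst.ofObj (τ : Obj → Tm L Obj 0) : Subst L Obj 0 0 := Sum.elim τ Fin.elim0

/-- The object symbol `o` as a term. -/
def Tm.obj {n : ℕ} (o : Obj) : Tm L Obj n := .var (.inl o)

/-- The substitution `[t/x]`. -/
def Subst.one [DecidableEq Obj] (x : Obj) (t : Tm L Obj 0) : Subst L Obj 0 0 :=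
  Subst.ofObj (Function.update Tm.obj x t)

/-- The simultaneous substitution `[t/x, s/y]`, for `x ≠ y`. -/
def Subst.two [DecidableEq Obj] (x : Obj) (t : Tm L Obj 0) (y : Obj) (s : Tm L Obj 0) :
    Subst L Obj 0 0 :=
  Subst.ofObj (Function.update (Function.update Tm.obj x t) y s)

/-- Capture-avoiding simultaneous substitution in a first-order formula. -/
def Form.subst : {n m : ℕ} → Form L Obj n → Subst L Obj n m → Form L Obj m
  | _, _, .top, _ => .top
  | _, _, .bot, _ => .bot
  | _, _, .eq t s, σ => .eq (FirstOrder.Language.Term.subst t σ)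
      (FirstOrder.Language.Term.subst s σ)
  | _, _, .rel P ts, σ => .rel P fun i => FirstOrder.Language.Term.subst (ts i) σ
  | _, _, .neg φ, σ => .neg (φ.subst σ)
  | _, _, .and φ ψ, σ => .and (φ.subst σ) (ψ.subst σ)
  | _, _, .or φ ψ, σ => .or (φ.subst σ) (ψ.subst σ)
  | _, _, .imp φ ψ, σ => .imp (φ.subst σ) (ψ.subst σ)
  | _, _, .iff φ ψ, σ => .iff (φ.subst σ) (ψ.subst σ)
  | _, _, .all φ, σ => .all (φ.subst (σ.lift 1))
  | _, _, .ex φ, σ => .ex (φ.subst (σ.lift 1))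

/-- Capture-avoiding simultaneous substitution in a definitional rule. -/
def Rule.subst {n m : ℕ} (r : Rule L Obj n) (σ : Subst L Obj n m) : Rule L Obj m where
  k := r.k
  head := r.head
  args := fun i => FirstOrder.Language.Term.subst (r.args i) (σ.lift r.k)
  body := r.body.subst (σ.lift r.k)

/-- Capture-avoiding simultaneous substitution in a definition. -/
def Defn.subst {n m : ℕ} (Φ : Defn L Obj n) (σ : Subst L Obj n m) : Defn L Obj m where
  rules := (fun r => r.subst σ) '' Φ.rules
  finite := Φ.finite.image _

/-- Capture-avoiding simultaneous substitution in a formula of FO(ID). -/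
def IDForm.subst : {n m : ℕ} → IDForm L Obj n → Subst L Obj n m → IDForm L Obj m
  | _, _, .top, _ => .top
  | _, _, .bot, _ => .bot
  | _, _, .eq t s, σ => .eq (FirstOrder.Language.Term.subst t σ)
      (FirstOrder.Language.Term.subst s σ)
  | _, _, .rel P ts, σ => .rel P fun i => FirstOrder.Language.Term.subst (ts i) σ
  | _, _, .defn Φ, σ => .defn (Φ.subst σ)
  | _, _, .neg φ, σ => .neg (φ.subst σ)
  | _, _, .and φ ψ, σ => .and (φ.subst σ) (ψ.subst σ)
  | _, _, .or φ ψ, σ => .or (φ.subst σ) (ψ.subst σ)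
  | _, _, .imp φ ψ, σ => .imp (φ.subst σ) (ψ.subst σ)
  | _, _, .iff φ ψ, σ => .iff (φ.subst σ) (ψ.subst σ)
  | _, _, .all φ, σ => .all (φ.subst (σ.lift 1))
  | _, _, .ex φ, σ => .ex (φ.subst (σ.lift 1))

/-- The set `Γ[σ]`. -/
def substSet (Γ : Set (IDForm L Obj 0)) (σ : Subst L Obj 0 0) : Set (IDForm L Obj 0) :=
  (fun φ => φ.subst σ) '' Γ

open Classical in
/-- `φ.replace S F true` replaces every positive occurrence of an atom `R(ū)` with `R ∈ S` in
`φ` by `F_R[ū]`; `φ.replace S F false` replaces the negative occurrences. Here `F_R` has its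
distinguished tuple `z̄` of object symbols open. Polarity is read off after unwinding `⇒` and
`⇔`: the premise of an implication is in the scope of one negation, and `φ ⇔ ψ` stands for
`(φ ⇒ ψ) ∧ (ψ ⇒ φ)`. -/
noncomputable def Form.replace (S : Set (Pred L)) (F : ∀ P : Pred L, Form L Obj P.1) :
    {n : ℕ} → Bool → Form L Obj n → Form L Obj n
  | _, _, .top => .top
  | _, _, .bot => .bot
  | _, _, .eq t s => .eq t s
  | _, b, .rel P ts => if b = true ∧ P ∈ S then (F P).subst (Subst.fill ts) else .rel P ts
  | _, b, .neg φ => .neg (φ.replace S F (!b))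
  | _, b, .and φ ψ => .and (φ.replace S F b) (ψ.replace S F b)
  | _, b, .or φ ψ => .or (φ.replace S F b) (ψ.replace S F b)
  | _, b, .imp φ ψ => .imp (φ.replace S F (!b)) (ψ.replace S F b)
  | _, b, .iff φ ψ => .and (.imp (φ.replace S F (!b)) (ψ.replace S F b))
      (.imp (ψ.replace S F (!b)) (φ.replace S F b))
  | _, b, .all φ => .all (φ.replace S F b)
  | _, b, .ex φ => .ex (φ.replace S F b)

/-! ### The sequent calculus -/

/-- The sequent calculus for FO(ID). `Prov cut Γ Δ` says that the sequent `Γ ⊢ Δ` has a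
derivation; the cut rule is available only if the proposition `cut` holds. -/
inductive Prov [DecidableEq Obj] (cut : Prop) :
    Set (IDForm L Obj 0) → Set (IDForm L Obj 0) → Prop
  | ax {Γ Δ : Set (IDForm L Obj 0)}
      (h : (Γ ∩ Δ).Nonempty ∨ IDForm.bot ∈ Γ ∨ IDForm.top ∈ Δ) : Prov cut Γ Δ
  | wk {Γ Γ' Δ Δ' : Set (IDForm L Obj 0)} (hΓ : Γ' ⊆ Γ) (hΔ : Δ' ⊆ Δ)
      (h : Prov cut Γ' Δ') : Prov cut Γ Δ
  | subst {Γ Δ : Set (IDForm L Obj 0)} (x : Obj) (t : Tm L Obj 0) (h : Prov cut Γ Δ) :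
      Prov cut (substSet Γ (Subst.one x t)) (substSet Δ (Subst.one x t))
  | cutRule {Γ Δ : Set (IDForm L Obj 0)} (hcut : cut) (φ : IDForm L Obj 0)
      (h₁ : Prov cut Γ (insert φ Δ)) (h₂ : Prov cut (insert φ Γ) Δ) : Prov cut Γ Δ
  | negL {Γ Δ : Set (IDForm L Obj 0)} (φ : IDForm L Obj 0)
      (h : Prov cut Γ (insert φ Δ)) : Prov cut (insert φ.neg Γ) Δ
  | negR {Γ Δ : Set (IDForm L Obj 0)} (φ : IDForm L Obj 0)
      (h : Prov cut (insert φ Γ) Δ) : Prov cut Γ (insert φ.neg Δ)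
  | orL {Γ Δ : Set (IDForm L Obj 0)} (φ ψ : IDForm L Obj 0)
      (h₁ : Prov cut (insert φ Γ) Δ) (h₂ : Prov cut (insert ψ Γ) Δ) :
      Prov cut (insert (φ.or ψ) Γ) Δ
  | orR {Γ Δ : Set (IDForm L Obj 0)} (φ ψ : IDForm L Obj 0)
      (h : Prov cut Γ (insert φ (insert ψ Δ))) : Prov cut Γ (insert (φ.or ψ) Δ)
  | andL {Γ Δ : Set (IDForm L Obj 0)} (φ ψ : IDForm L Obj 0)
      (h : Prov cut (insert φ (insert ψ Γ)) Δ) : Prov cut (insert (φ.and ψ) Γ) Δ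
  | andR {Γ Δ : Set (IDForm L Obj 0)} (φ ψ : IDForm L Obj 0)
      (h₁ : Prov cut Γ (insert φ Δ)) (h₂ : Prov cut Γ (insert ψ Δ)) :
      Prov cut Γ (insert (φ.and ψ) Δ)
  | impL {Γ Δ : Set (IDForm L Obj 0)} (φ ψ : IDForm L Obj 0)
      (h₁ : Prov cut Γ (insert φ Δ)) (h₂ : Prov cut (insert ψ Γ) Δ) :
      Prov cut (insert (φ.imp ψ) Γ) Δ
  | impR {Γ Δ : Set (IDForm L Obj 0)} (φ ψ : IDForm L Obj 0)
      (h : Prov cut (insert φ Γ) (insert ψ Δ)) : Prov cut Γ (insert (φ.imp ψ) Δ)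
  | iffL {Γ Δ : Set (IDForm L Obj 0)} (φ ψ : IDForm L Obj 0)
      (h₁ : Prov cut Γ (insert φ (insert ψ Δ))) (h₂ : Prov cut (insert φ (insert ψ Γ)) Δ) :
      Prov cut (insert (φ.iff ψ) Γ) Δ
  | iffR {Γ Δ : Set (IDForm L Obj 0)} (φ ψ : IDForm L Obj 0)
      (h₁ : Prov cut (insert φ Γ) (insert ψ Δ)) (h₂ : Prov cut (insert ψ Γ) (insert φ Δ)) :
      Prov cut Γ (insert (φ.iff ψ) Δ)
  | allL {Γ Δ : Set (IDForm L Obj 0)} (φ : IDForm L Obj 1) (t : Tm L Obj 0)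
      (h : Prov cut (insert (φ.subst (Subst.fill fun _ => t)) Γ) Δ) :
      Prov cut (insert φ.all Γ) Δ
  | allR {Γ Δ : Set (IDForm L Obj 0)} (φ : IDForm L Obj 1) (x : Obj)
      (hx : x ∉ freeIn Γ ∪ freeIn Δ ∪ φ.free)
      (h : Prov cut Γ (insert (φ.subst (Subst.fill fun _ => Tm.obj x)) Δ)) :
      Prov cut Γ (insert φ.all Δ)
  | exL {Γ Δ : Set (IDForm L Obj 0)} (φ : IDForm L Obj 1) (x : Obj)
      (hx : x ∉ freeIn Γ ∪ freeIn Δ ∪ φ.free)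
      (h : Prov cut (insert (φ.subst (Subst.fill fun _ => Tm.obj x)) Γ) Δ) :
      Prov cut (insert φ.ex Γ) Δ
  | exR {Γ Δ : Set (IDForm L Obj 0)} (φ : IDForm L Obj 1) (t : Tm L Obj 0)
      (h : Prov cut Γ (insert (φ.subst (Subst.fill fun _ => t)) Δ)) :
      Prov cut Γ (insert φ.ex Δ)
  | eqL {Γ Δ : Set (IDForm L Obj 0)} (x y : Obj) (hxy : x ≠ y) (t s : Tm L Obj 0)
      (h : Prov cut (substSet Γ (Subst.two x s y t)) (substSet Δ (Subst.two x s y t))) :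
      Prov cut (insert (.eq t s) (substSet Γ (Subst.two x t y s)))
        (substSet Δ (Subst.two x t y s))
  | eqR {Γ Δ : Set (IDForm L Obj 0)} (t : Tm L Obj 0) : Prov cut Γ (insert (.eq t t) Δ)
  /-- From `Γ, Φ ⊢ φ[s̄/x̄], Δ` infer `Γ, Φ ⊢ P(t̄[s̄/x̄]), Δ`, for a rule `∀ x̄ : P(t̄) ← φ`
  of `Φ` and a tuple of terms `s̄`. -/
  | defR {Γ Δ : Set (IDForm L Obj 0)} (Φ : Defn L Obj 0) (r : Rule L Obj 0)
      (hr : r ∈ Φ.rules) (s : Fin (0 + r.k) → Tm L Obj 0)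
      (h : Prov cut (insert (.defn Φ) Γ) (insert (r.body.subst (Subst.fill s)).toID Δ)) :
      Prov cut (insert (.defn Φ) Γ)
        (insert (.rel r.head fun i =>
          FirstOrder.Language.Term.subst (r.args i) (Subst.fill s)) Δ)
  /-- The induction rule, for a set `S` of defined predicates of `Φ`, a predicate `P ∈ S` and
  first-order induction hypotheses `F Q`, `Q ∈ S`. The quantified tuple of a rule `r` of `Φ` is
  named by the distinct object symbols `y r`, which occur freely neither in the context nor in
  the induction hypotheses. -/
  | defL {Γ Δ : Set (IDForm L Obj 0)} (Φ : Defn L Obj 0) (S : Set (Pred L))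
      (hS : S ⊆ Φ.defined) (F : ∀ Q : Pred L, Form L Obj Q.1) (P : Pred L) (hP : P ∈ S)
      (ts : Fin P.1 → Tm L Obj 0) (y : ∀ r : Rule L Obj 0, Fin (0 + r.k) → Obj)
      (hinj : ∀ r ∈ Φ.rules, Function.Injective (y r))
      (hctx : ∀ r ∈ Φ.rules, ∀ i, y r i ∉ freeIn Γ ∪ freeIn Δ ∪ Φ.free)
      (hhyp : ∀ r ∈ Φ.rules, ∀ i, ∀ Q ∈ S, y r i ∉ (F Q).free)
      (hminor : ∀ r ∈ Φ.rules, r.head ∈ S →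
        Prov cut
          (insert ((r.body.replace S F true).subst (Subst.fill fun i => Tm.obj (y r i))).toID
            (insert (.defn Φ) Γ))
          (insert ((F r.head).subst (Subst.fill fun j =>
            FirstOrder.Language.Term.subst (r.args j)
              (Subst.fill fun i => Tm.obj (y r i)))).toID Δ))
      (hmajor : Prov cut
        (insert ((F P).subst (Subst.fill ts)).toID (insert (.defn Φ) Γ)) Δ) :
      Prov cut (insert (.rel P ts) (insert (.defn Φ) Γ)) Δ

/-- The sequent `Γ ⊢ Δ` has a proof without cuts. -/
def CutFreeProvable [DecidableEq Obj] (Γ Δ : Set (IDForm L Obj 0)) : Prop := Prov False Γ Δ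

/-! ### Henkin semantics

A structure consists of a domain `M` with an `L.Structure M`, and values `v : Obj → M` of the
object symbols. The values of the open bound object symbols are given by `xs : Fin n → M`. -/

/-- An interpretation of all predicate symbols in the domain `M`. -/
abbrev Interp (L : FirstOrder.Language.{u, v}) (M : Type*) := ∀ P : Pred L, Set (Fin P.1 → M)

/-- The interpretation of the predicate symbols in a structure. -/
def interp (L : FirstOrder.Language.{u, v}) (M : Type*) [L.Structure M] : Interp L M :=
  fun P => {a | FirstOrder.Language.Structure.RelMap P.2 a}

/-- Truth of `φ` when the positive occurrences of predicate symbols are interpreted by `I` and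
the negative ones by `J`. Function symbols are interpreted by the `L.Structure` on `M`. -/
def Form.Holds {M : Type*} [L.Structure M] (v : Obj → M) :
    {n : ℕ} → Interp L M → Interp L M → Form L Obj n → (Fin n → M) → Prop
  | _, _, _, .top, _ => True
  | _, _, _, .bot, _ => False
  | _, _, _, .eq t s, xs => t.realize (Sum.elim v xs) = s.realize (Sum.elim v xs)
  | _, I, _, .rel P ts, xs => (fun i => (ts i).realize (Sum.elim v xs)) ∈ I P
  | _, I, J, .neg φ, xs => ¬ φ.Holds v J I xs
  | _, I, J, .and φ ψ, xs => φ.Holds v I J xs ∧ ψ.Holds v I J xs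
  | _, I, J, .or φ ψ, xs => φ.Holds v I J xs ∨ ψ.Holds v I J xs
  | _, I, J, .imp φ ψ, xs => φ.Holds v J I xs → ψ.Holds v I J xs
  | _, I, J, .iff φ ψ, xs => (φ.Holds v J I xs → ψ.Holds v I J xs) ∧
      (ψ.Holds v J I xs → φ.Holds v I J xs)
  | _, I, J, .all φ, xs => ∀ a : M, φ.Holds v I J (Fin.snoc (α := fun _ => M) xs a)
  | _, I, J, .ex φ, xs => ∃ a : M, φ.Holds v I J (Fin.snoc (α := fun _ => M) xs a)

/-- The operator `C(J, I)` of a definition: a tuple belongs to the new value of `P` if it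
satisfies the merged body `⋁ ∃ x̄ : ȳ = t̄ ∧ φ` over the rules `∀ x̄ : P(t̄) ← φ`, where positive
occurrences of predicates are interpreted by `J` and negative ones by `I`. Only the values at
defined predicates are meaningful. -/
def Defn.step {M : Type*} [L.Structure M] {n : ℕ} (Φ : Defn L Obj n) (v : Obj → M)
    (xs : Fin n → M) (J I : Interp L M) : Interp L M :=
  fun P => {a | ∃ r ∈ Φ.rules, ∃ b : Fin r.k → M,
    (⟨P, a⟩ : Σ Q : Pred L, Fin Q.1 → M) =
      ⟨r.head, fun i => (r.args i).realize (Sum.elim v (Fin.append xs b))⟩ ∧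
    r.body.Holds v J I (Fin.append xs b)}

/-- A Henkin class for the structure `M`. In `terms`, the tuple `t̄` consists of terms in
object symbols `x₁, …, xₙ` and in object symbols whose values are fixed elements of `M`. -/
structure HenkinClass (L : FirstOrder.Language.{u, v}) {M : Type*} [L.Structure M]
    (H : ∀ k : ℕ, Set (Set (Fin k → M))) : Prop where
  diag : {a : Fin 2 → M | a 0 = a 1} ∈ H 2
  pred : ∀ P : Pred L, interp L M P ∈ H P.1
  proj : ∀ (k : ℕ) (R : Set (Fin (k + 1) → M)) (a : M), R ∈ H (k + 1) →
    {x : Fin k → M | Fin.snoc (α := fun _ => M) x a ∈ R} ∈ H k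
  terms : ∀ (k n : ℕ) (R : Set (Fin k → M)) (t : Fin k → L.Term (M ⊕ Fin n)), R ∈ H k →
    {a : Fin n → M | (fun i => (t i).realize (Sum.elim id a)) ∈ R} ∈ H n
  compl : ∀ (k : ℕ) (R : Set (Fin k → M)), R ∈ H k → Rᶜ ∈ H k
  inter : ∀ (k : ℕ) (R S : Set (Fin k → M)), R ∈ H k → S ∈ H k → R ∩ S ∈ H k
  all : ∀ (k : ℕ) (R : Set (Fin (k + 1) → M)), R ∈ H (k + 1) →
    {x : Fin k → M | ∀ a : M, Fin.snoc (α := fun _ => M) x a ∈ R} ∈ H k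

/-- The structure `M` is a Henkin model of `Φ` with respect to `H`: among the interpretations
`J` that agree with it outside the defined predicates, it is the least one that gives the
defined predicates values in `H` and satisfies `C(J, M) ⊑ J`. -/
def Defn.HenkinModel {M : Type*} [L.Structure M] (H : ∀ k : ℕ, Set (Set (Fin k → M)))
    {n : ℕ} (Φ : Defn L Obj n) (v : Obj → M) (xs : Fin n → M) : Prop :=
  IsLeast {J : Interp L M | (∀ P ∉ Φ.defined, J P = interp L M P) ∧
    ∀ P ∈ Φ.defined, J P ∈ H P.1 ∧ Φ.step v xs J (interp L M) P ⊆ J P} (interp L M)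

/-- Henkin satisfaction of formulas of FO(ID). -/
def IDForm.Sat {M : Type*} [L.Structure M] (H : ∀ k : ℕ, Set (Set (Fin k → M)))
    (v : Obj → M) : {n : ℕ} → IDForm L Obj n → (Fin n → M) → Prop
  | _, .top, _ => True
  | _, .bot, _ => False
  | _, .eq t s, xs => t.realize (Sum.elim v xs) = s.realize (Sum.elim v xs)
  | _, .rel P ts, xs => (fun i => (ts i).realize (Sum.elim v xs)) ∈ interp L M P
  | _, .defn Φ, xs => Φ.HenkinModel H v xs
  | _, .neg φ, xs => ¬ φ.Sat H v xs
  | _, .and φ ψ, xs => φ.Sat H v xs ∧ ψ.Sat H v xs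
  | _, .or φ ψ, xs => φ.Sat H v xs ∨ ψ.Sat H v xs
  | _, .imp φ ψ, xs => φ.Sat H v xs → ψ.Sat H v xs
  | _, .iff φ ψ, xs => φ.Sat H v xs ↔ ψ.Sat H v xs
  | _, .all φ, xs => ∀ a : M, φ.Sat H v (Fin.snoc (α := fun _ => M) xs a)
  | _, .ex φ, xs => ∃ a : M, φ.Sat H v (Fin.snoc (α := fun _ => M) xs a)

/-- The sequent `Γ ⊢ Δ` is valid under the Henkin semantics. -/
def HenkinValid (Γ Δ : Set (IDForm L Obj 0)) : Prop :=
  ∀ (M : Type (max u w)) [L.Structure M] (v : Obj → M) (H : ∀ k : ℕ, Set (Set (Fin k → M))),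
    HenkinClass L H → (∀ φ ∈ Γ, φ.Sat H v Fin.elim0) → ∃ ψ ∈ Δ, ψ.Sat H v Fin.elim0

/-! ### Canonical sequents -/

/-- The formula is an atom. -/
def Form.IsAtom {n : ℕ} : Form L Obj n → Prop
  | .top => True
  | .bot => True
  | .eq _ _ => True
  | .rel _ _ => True
  | _ => False

/-- Formulas composed of literals (atoms and negated atoms) by conjunctions and disjunctions. -/
inductive Form.IsLitComb {n : ℕ} : Form L Obj n → Prop
  | atom (φ : Form L Obj n) (h : φ.IsAtom) : Form.IsLitComb φ
  | negAtom (φ : Form L Obj n) (h : φ.IsAtom) : Form.IsLitComb φ.neg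
  | and (φ ψ : Form L Obj n) (h₁ : Form.IsLitComb φ) (h₂ : Form.IsLitComb ψ) :
      Form.IsLitComb (φ.and ψ)
  | or (φ ψ : Form L Obj n) (h₁ : Form.IsLitComb φ) (h₂ : Form.IsLitComb ψ) :
      Form.IsLitComb (φ.or ψ)

/-- No negation symbol occurs in the formula. -/
def Form.NegFree : {n : ℕ} → Form L Obj n → Prop
  | _, .top => True
  | _, .bot => True
  | _, .eq _ _ => True
  | _, .rel _ _ => True
  | _, .neg _ => False
  | _, .and φ ψ => φ.NegFree ∧ ψ.NegFree
  | _, .or φ ψ => φ.NegFree ∧ ψ.NegFree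
  | _, .imp φ ψ => φ.NegFree ∧ ψ.NegFree
  | _, .iff φ ψ => φ.NegFree ∧ ψ.NegFree
  | _, .all φ => φ.NegFree
  | _, .ex φ => φ.NegFree

/-- The sequent `Γ, Φ₁, …, Φₙ ⊢ Δ` with first-order formulas in `Γ` and `Δ` is canonical. -/
structure Canonical {n : ℕ} (Γ : Set (Form L Obj 0)) (Φ : Fin n → Defn L Obj 0)
    (Δ : Set (Form L Obj 0)) : Prop where
  finite_left : Γ.Finite
  finite_right : Δ.Finite
  body : ∀ i, ∀ r ∈ (Φ i).rules, r.body.IsLitComb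
  disjoint : ∀ i j, i ≠ j → Disjoint (Φ i).defined (Φ j).defined
  stratified : ∀ i j, j < i → Disjoint (Φ i).defined (Φ j).params

/-- The left-hand side `Γ, Φ₁, …, Φₙ`. -/
def antecedent {n : ℕ} (Γ : Set (Form L Obj 0)) (Φ : Fin n → Defn L Obj 0) :
    Set (IDForm L Obj 0) :=
  Form.toID '' Γ ∪ Set.range fun i => IDForm.defn (Φ i)

/-- The right-hand side `Δ`. -/
def succedent (Δ : Set (Form L Obj 0)) : Set (IDForm L Obj 0) := Form.toID '' Δ

end FOID

/-! ### Syntactic preliminaries: substitution, fresh symbols, countably many formulas over `S` -/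

namespace FOID

open FirstOrder Language

variable {L : FirstOrder.Language.{u, v}} {Obj : Type w}

/-! ### Composition of substitutions -/

/-! The proof is a Henkin construction that does without cut. Assume that the sequent has no
cut-free proof, and fix a countable set `S` of symbols that contains those of the sequent and
infinitely many object symbols. By `exists_generic` the two sides extend to sets `A` and `B` such
that no finite part of the pair is cut-free provable, the pair is maximal for formulas over `S`, and
it contains witnesses for the eigenvariable rules and for (def L). Without cut, a formula may belong
to neither set. So each inference rule, read backwards, becomes a closure property of the pair, and
the truth lemma `Generic.truth` consists of two separate halves: members of `A` are true, members of
`B` are false.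

The domain consists of the closed terms modulo indiscernibility by membership in `A` and `B`. The
predicates receive the least values `preds` that make the atoms in `A` true and are closed under all
definitional rules; these exist because bodies without negation give monotone operators. Atoms in
`B` stay false: by (def R), the largest interpretation that avoids `B` is itself closed under the
rules (`Generic.avoid_closed`), hence lies above `preds`.

The Henkin class consists of the sets definable by first-order formulas. For `Generic.henkinModel`,
let `I` be the interpretation `preds`, and let `J` be a competitor for one definition, with
definable values. It suffices that `J ⊓ I` makes the atoms in `A` true and is closed under all
rules, for then `I ≤ J ⊓ I` by leastness. For an atom in `A` with a predicate defined there, (def L)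
is used with the formulas that define `J` as induction hypotheses. Either the hypothesis for the
atom is in `A`, hence true, so that the atom holds in `J`; or for some rule instance the body, with
hypotheses substituted, is in `A` and the hypothesis for the head is in `B`, which contradicts the
closure of `J` under the rule. The resulting Henkin model satisfies the left side and refutes the
right side. -/

theorem term_relabel_subst {α β γ : Type*} (t : L.Term α) (g : α → β) (σ : β → L.Term γ) :
    (t.relabel g).subst σ = t.subst (fun a => σ (g a)) := by
  induction t with
  | var a => rfl
  | func f ts ih => simp [Term.relabel, Term.subst, ih]

theorem term_subst_relabel {α β γ : Type*} (t : L.Term α) (σ : α → L.Term β) (g : β → γ) :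
    (t.subst σ).relabel g = t.subst (fun a => (σ a).relabel g) := by
  induction t with
  | var a => rfl
  | func f ts ih => simp [Term.relabel, Term.subst, ih]

theorem term_subst_subst {α β γ : Type*} (t : L.Term α) (σ : α → L.Term β) (τ : β → L.Term γ) :
    (t.subst σ).subst τ = t.subst (fun a => (σ a).subst τ) := by
  induction t with
  | var a => rfl
  | func f ts ih => simp [Term.subst, ih]

/-- Composition of substitutions. -/
def Subst.comp {n m l : ℕ} (σ : Subst L Obj n m) (τ : Subst L Obj m l) : Subst L Obj n l :=
  fun x => (σ x).subst τ

@[simp] theorem Subst.lift_inl {n m : ℕ} (k : ℕ) (σ : Subst L Obj n m) (o : Obj) :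
    σ.lift k (.inl o) = (σ (.inl o)).relabel (Sum.map id (Fin.castAdd k)) := rfl

@[simp] theorem Subst.lift_castAdd {n m : ℕ} (k : ℕ) (σ : Subst L Obj n m) (i : Fin n) :
    σ.lift k (.inr (Fin.castAdd k i)) = (σ (.inr i)).relabel (Sum.map id (Fin.castAdd k)) := by
  simp [Subst.lift]

@[simp] theorem Subst.lift_natAdd {n m : ℕ} (k : ℕ) (σ : Subst L Obj n m) (i : Fin k) :
    σ.lift k (.inr (Fin.natAdd n i)) = .var (.inr (Fin.natAdd m i)) := by
  simp [Subst.lift]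

theorem Subst.lift_castSucc {n m : ℕ} (σ : Subst L Obj n m) (i : Fin n) :
    σ.lift 1 (.inr i.castSucc) = (σ (.inr i)).relabel (Sum.map id (Fin.castAdd 1)) :=
  σ.lift_castAdd 1 i

theorem Subst.lift_last {n m : ℕ} (σ : Subst L Obj n m) :
    σ.lift 1 (.inr (Fin.last n)) = .var (.inr (Fin.last m)) :=
  σ.lift_natAdd 1 0

theorem relabel_castAdd_subst_lift {m l : ℕ} (k : ℕ) (t : Tm L Obj m) (τ : Subst L Obj m l) :
    Term.subst (t.relabel (Sum.map id (Fin.castAdd k))) (τ.lift k) =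
      (Term.subst t τ).relabel (Sum.map id (Fin.castAdd k)) := by
  rw [term_relabel_subst, term_subst_relabel]
  congr 1
  funext x
  rcases x with o | i <;> simp

theorem Subst.lift_comp {n m l : ℕ} (k : ℕ) (σ : Subst L Obj n m) (τ : Subst L Obj m l) :
    (σ.lift k).comp (τ.lift k) = (σ.comp τ).lift k := by
  funext x
  rcases x with o | i
  · exact relabel_castAdd_subst_lift k _ τ
  · refine Fin.addCases (fun j => ?_) (fun j => ?_) i
    · simp [Subst.comp, relabel_castAdd_subst_lift]
    · simp [Subst.comp, Term.subst]

theorem Form.subst_subst {n m l : ℕ} (φ : Form L Obj n) (σ : Subst L Obj n m)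
    (τ : Subst L Obj m l) : (φ.subst σ).subst τ = φ.subst (σ.comp τ) := by
  induction φ generalizing m l with
  | top | bot => rfl
  | eq t s =>
    simp only [Form.subst, term_subst_subst]
    rfl
  | rel P ts =>
    simp only [Form.subst, term_subst_subst]
    rfl
  | neg φ ih => simp [Form.subst, ih]
  | and φ ψ ih₁ ih₂ | or φ ψ ih₁ ih₂ | imp φ ψ ih₁ ih₂ | iff φ ψ ih₁ ih₂ =>
    simp [Form.subst, ih₁, ih₂]
  | all φ ih | ex φ ih => simp [Form.subst, ih, Subst.lift_comp]

theorem Form.subst_toID {n m : ℕ} (φ : Form L Obj n) (σ : Subst L Obj n m) :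
    (φ.subst σ).toID = φ.toID.subst σ := by
  induction φ generalizing m with
  | top | bot | eq t s | rel P ts => rfl
  | neg φ ih => simp [Form.subst, Form.toID, IDForm.subst, ih]
  | and φ ψ ih₁ ih₂ | or φ ψ ih₁ ih₂ | imp φ ψ ih₁ ih₂ | iff φ ψ ih₁ ih₂ =>
    simp [Form.subst, Form.toID, IDForm.subst, ih₁, ih₂]
  | all φ ih | ex φ ih => simp [Form.subst, Form.toID, IDForm.subst, ih]

theorem Form.free_toID {n : ℕ} (φ : Form L Obj n) : φ.toID.free = φ.free := by
  induction φ <;> simp_all [Form.toID, Form.free, IDForm.free]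

/-! ### Substitutions that fix the free object symbols -/

/-- `σ` maps the free object symbols in `X` and all open bound ones to themselves. -/
def Subst.Fixes {n : ℕ} (σ : Subst L Obj n n) (X : Set Obj) : Prop :=
  (∀ o ∈ X, σ (.inl o) = .var (.inl o)) ∧ ∀ i, σ (.inr i) = .var (.inr i)

theorem Subst.Fixes.mono {n : ℕ} {σ : Subst L Obj n n} {X Y : Set Obj} (h : σ.Fixes Y)
    (hXY : X ⊆ Y) : σ.Fixes X :=
  ⟨fun o ho => h.1 o (hXY ho), h.2⟩

theorem Subst.Fixes.lift {n : ℕ} {σ : Subst L Obj n n} {X : Set Obj} (h : σ.Fixes X) (k : ℕ) :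
    (σ.lift k).Fixes X := by
  refine ⟨fun o ho => by simp [h.1 o ho, Term.relabel], fun i => ?_⟩
  refine Fin.addCases (fun j => ?_) (fun j => ?_) i <;> simp [h.2, Term.relabel]

theorem Tm.subst_eq_self {n : ℕ} {t : Tm L Obj n} {σ : Subst L Obj n n}
    (h : σ.Fixes (Tm.free t)) : Term.subst t σ = t := by
  induction t with
  | var x =>
    rcases x with o | i
    · exact h.1 o rfl
    · exact h.2 i
  | func f ts ih =>
    simp only [Term.subst, Term.func.injEq, heq_eq_eq, true_and]
    funext i
    refine ih i (h.mono ?_)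
    rw [Tm.free]
    exact Set.subset_iUnion (fun i => Tm.free (ts i)) i

theorem Form.subst_eq_self {n : ℕ} {φ : Form L Obj n} {σ : Subst L Obj n n}
    (h : σ.Fixes φ.free) : φ.subst σ = φ := by
  induction φ with
  | top | bot => rfl
  | eq t s =>
    simp only [Form.subst]
    rw [Tm.subst_eq_self (h.mono Set.subset_union_left),
      Tm.subst_eq_self (h.mono Set.subset_union_right)]
  | rel P ts =>
    simp only [Form.subst]
    congr 1
    funext i
    exact Tm.subst_eq_self (h.mono (Set.subset_iUnion (fun i => Tm.free (ts i)) i))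
  | neg φ ih => simp only [Form.subst, ih h]
  | and φ ψ ih₁ ih₂ | or φ ψ ih₁ ih₂ | imp φ ψ ih₁ ih₂ | iff φ ψ ih₁ ih₂ =>
    simp only [Form.subst, ih₁ (h.mono Set.subset_union_left),
      ih₂ (h.mono Set.subset_union_right)]
  | all φ ih | ex φ ih => simp only [Form.subst, ih (Subst.Fixes.lift h 1)]

theorem Rule.subst_eq_self {n : ℕ} {r : Rule L Obj n} {σ : Subst L Obj n n}
    (h : σ.Fixes {o | (∃ i, o ∈ Tm.free (r.args i)) ∨ o ∈ r.body.free}) : r.subst σ = r := by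
  obtain ⟨k, P, ts, φ⟩ := r
  simp only [Rule.subst, Rule.mk.injEq, heq_eq_eq, true_and]
  refine ⟨?_, Form.subst_eq_self ((h.lift k).mono fun o ho => Or.inr ho)⟩
  funext i
  exact Tm.subst_eq_self ((h.lift k).mono fun o ho => Or.inl ⟨i, ho⟩)

theorem Defn.subst_eq_self {n : ℕ} {Φ : Defn L Obj n} {σ : Subst L Obj n n}
    (h : σ.Fixes Φ.free) : Φ.subst σ = Φ := by
  obtain ⟨R, hR⟩ := Φ
  simp only [Defn.subst, Defn.mk.injEq]
  have : ∀ r ∈ R, r.subst σ = r := fun r hr =>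
    Rule.subst_eq_self (h.mono fun o ho => ⟨r, hr, ho⟩)
  rw [Set.image_congr this, Set.image_id']

/-! ### Finiteness of the set of free object symbols -/

theorem Tm.free_finite {n : ℕ} (t : Tm L Obj n) : (Tm.free t).Finite := by
  induction t with
  | var x => rcases x with o | i <;> simp [Tm.free]
  | func f ts ih => simpa [Tm.free] using Set.finite_iUnion ih

theorem Form.free_finite {n : ℕ} (φ : Form L Obj n) : φ.free.Finite := by
  induction φ with
  | top | bot => exact Set.finite_empty
  | eq t s => exact (Tm.free_finite t).union (Tm.free_finite s)
  | rel P ts => exact Set.finite_iUnion fun i => Tm.free_finite (ts i)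
  | neg φ ih | all φ ih | ex φ ih => exact ih
  | and φ ψ ih₁ ih₂ | or φ ψ ih₁ ih₂ | imp φ ψ ih₁ ih₂ | iff φ ψ ih₁ ih₂ => exact ih₁.union ih₂

theorem Defn.free_finite {n : ℕ} (Φ : Defn L Obj n) : Φ.free.Finite := by
  refine (Φ.finite.biUnion (t := fun r => (⋃ i, Tm.free (r.args i)) ∪ r.body.free) fun r _ =>
    (Set.finite_iUnion fun i => Tm.free_finite (r.args i)).union r.body.free_finite).subset ?_
  rintro o ⟨r, hr, h⟩
  refine Set.mem_biUnion hr ?_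
  simpa using h

theorem Defn.defined_finite {n : ℕ} (Φ : Defn L Obj n) : Φ.defined.Finite :=
  Φ.finite.image Rule.head

/-! ### Symbols -/

/-- Function symbols, predicate symbols and object symbols. -/
abbrev Sym (L : FirstOrder.Language.{u, v}) (Obj : Type w) : Type (max u v w) :=
  (Σ k, L.Functions k) ⊕ (Pred L ⊕ Obj)

/-- The set `S` contains all symbols of the term. -/
def Tm.Over (S : Set (Sym L Obj)) {n : ℕ} : Tm L Obj n → Prop
  | .var (.inl o) => .inr (.inr o) ∈ S
  | .var (.inr _) => True
  | .func (l := k) f ts => .inl ⟨k, f⟩ ∈ S ∧ ∀ i, Tm.Over S (ts i)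

/-- The set `S` contains all symbols of the formula. -/
def Form.Over (S : Set (Sym L Obj)) : {n : ℕ} → Form L Obj n → Prop
  | _, .top => True
  | _, .bot => True
  | _, .eq t s => Tm.Over S t ∧ Tm.Over S s
  | _, .rel P ts => .inr (.inl P) ∈ S ∧ ∀ i, Tm.Over S (ts i)
  | _, .neg φ => φ.Over S
  | _, .and φ ψ => φ.Over S ∧ ψ.Over S
  | _, .or φ ψ => φ.Over S ∧ ψ.Over S
  | _, .imp φ ψ => φ.Over S ∧ ψ.Over S
  | _, .iff φ ψ => φ.Over S ∧ ψ.Over S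
  | _, .all φ => φ.Over S
  | _, .ex φ => φ.Over S

theorem Tm.Over.mono {S S' : Set (Sym L Obj)} (hS : S ⊆ S') {n : ℕ} {t : Tm L Obj n}
    (h : Tm.Over S t) : Tm.Over S' t := by
  induction t with
  | var x =>
    rcases x with o | i
    · exact hS h
    · trivial
  | func f ts ih => exact ⟨hS h.1, fun i => ih i (h.2 i)⟩

theorem Form.Over.mono {S S' : Set (Sym L Obj)} (hS : S ⊆ S') {n : ℕ} {φ : Form L Obj n}
    (h : φ.Over S) : φ.Over S' := by
  induction φ with
  | top | bot => trivial
  | eq t s => exact ⟨h.1.mono hS, h.2.mono hS⟩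
  | rel P ts => exact ⟨hS h.1, fun i => (h.2 i).mono hS⟩
  | neg φ ih | all φ ih | ex φ ih => exact ih h
  | and φ ψ ih₁ ih₂ | or φ ψ ih₁ ih₂ | imp φ ψ ih₁ ih₂ | iff φ ψ ih₁ ih₂ =>
    exact ⟨ih₁ h.1, ih₂ h.2⟩

theorem Tm.exists_over {n : ℕ} (t : Tm L Obj n) : ∃ S : Set (Sym L Obj), S.Finite ∧ Tm.Over S t := by
  induction t with
  | var x =>
    rcases x with o | i
    · exact ⟨{.inr (.inr o)}, Set.finite_singleton _, Set.mem_singleton _⟩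
    · exact ⟨∅, Set.finite_empty, trivial⟩
  | func f ts ih =>
    choose S hS h using ih
    exact ⟨insert (.inl ⟨_, f⟩) (⋃ i, S i), (Set.finite_iUnion hS).insert _,
      Set.mem_insert _ _, fun i => (h i).mono
        ((Set.subset_iUnion S i).trans (Set.subset_insert _ _))⟩

theorem Form.exists_over {n : ℕ} (φ : Form L Obj n) :
    ∃ S : Set (Sym L Obj), S.Finite ∧ φ.Over S := by
  induction φ with
  | top | bot => exact ⟨∅, Set.finite_empty, trivial⟩
  | eq t s =>
    obtain ⟨S, hS, h⟩ := Tm.exists_over t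
    obtain ⟨S', hS', h'⟩ := Tm.exists_over s
    exact ⟨S ∪ S', hS.union hS', h.mono Set.subset_union_left, h'.mono Set.subset_union_right⟩
  | rel P ts =>
    choose S hS h using fun i => Tm.exists_over (ts i)
    exact ⟨insert (.inr (.inl P)) (⋃ i, S i), (Set.finite_iUnion hS).insert _,
      Set.mem_insert _ _, fun i => (h i).mono
        ((Set.subset_iUnion S i).trans (Set.subset_insert _ _))⟩
  | neg φ ih | all φ ih | ex φ ih => exact ih
  | and φ ψ ih₁ ih₂ | or φ ψ ih₁ ih₂ | imp φ ψ ih₁ ih₂ | iff φ ψ ih₁ ih₂ =>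
    obtain ⟨S, hS, h⟩ := ih₁
    obtain ⟨S', hS', h'⟩ := ih₂
    exact ⟨S ∪ S', hS.union hS', h.mono Set.subset_union_left, h'.mono Set.subset_union_right⟩

/-- The substitution introduces only symbols in `S`, provided it is applied to such symbols. -/
def Subst.Over (S : Set (Sym L Obj)) {n m : ℕ} (σ : Subst L Obj n m) : Prop :=
  (∀ o, .inr (.inr o) ∈ S → Tm.Over S (σ (.inl o))) ∧ ∀ i, Tm.Over S (σ (.inr i))

theorem Tm.Over.relabel {S : Set (Sym L Obj)} {n m : ℕ} {t : Tm L Obj n} (h : Tm.Over S t)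
    (g : Fin n → Fin m) : Tm.Over (n := m) S (t.relabel (Sum.map id g)) := by
  induction t with
  | var x => rcases x with o | i <;> exact h
  | func f ts ih => exact ⟨h.1, fun i => ih i (h.2 i)⟩

theorem Tm.Over.subst {S : Set (Sym L Obj)} {n m : ℕ} {t : Tm L Obj n} (h : Tm.Over S t)
    {σ : Subst L Obj n m} (hσ : σ.Over S) : Tm.Over (n := m) S (Term.subst t σ) := by
  induction t with
  | var x =>
    rcases x with o | i
    · exact hσ.1 o h
    · exact hσ.2 i
  | func f ts ih => exact ⟨h.1, fun i => ih i (h.2 i)⟩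

theorem Subst.Over.lift {S : Set (Sym L Obj)} {n m : ℕ} {σ : Subst L Obj n m} (hσ : σ.Over S)
    (k : ℕ) : (σ.lift k).Over S := by
  refine ⟨fun o ho => (hσ.1 o ho).relabel _, fun i => ?_⟩
  refine Fin.addCases (fun j => ?_) (fun j => ?_) i
  · rw [Subst.lift_castAdd]
    exact (hσ.2 j).relabel _
  · rw [Subst.lift_natAdd]
    trivial

theorem Form.Over.subst {S : Set (Sym L Obj)} {n m : ℕ} {φ : Form L Obj n} (h : φ.Over S)
    {σ : Subst L Obj n m} (hσ : σ.Over S) : (φ.subst σ).Over S := by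
  induction φ generalizing m with
  | top | bot => trivial
  | eq t s => exact ⟨h.1.subst hσ, h.2.subst hσ⟩
  | rel P ts => exact ⟨h.1, fun i => (h.2 i).subst hσ⟩
  | neg φ ih => exact ih h hσ
  | all φ ih | ex φ ih => exact ih h (hσ.lift 1)
  | and φ ψ ih₁ ih₂ | or φ ψ ih₁ ih₂ | imp φ ψ ih₁ ih₂ | iff φ ψ ih₁ ih₂ =>
    exact ⟨ih₁ h.1 hσ, ih₂ h.2 hσ⟩

theorem Subst.over_fill {S : Set (Sym L Obj)} {n m : ℕ} {ts : Fin n → Tm L Obj m}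
    (h : ∀ i, Tm.Over S (ts i)) : (Subst.fill ts).Over S :=
  ⟨fun _ ho => ho, h⟩

/-! ### Countability of the set of formulas over a countable set of symbols -/

/-- Terms over `S` of height less than `d`. -/
def tmLevel (S : Set (Sym L Obj)) (n : ℕ) : ℕ → Set (Tm L Obj n)
  | 0 => ∅
  | d + 1 => (Set.range fun i : Fin n => .var (.inr i)) ∪
      (⋃ x ∈ S, Sum.elim
        (fun f => (fun ts => .func f.2 ts) '' {ts : Fin f.1 → Tm L Obj n | ∀ i, ts i ∈ tmLevel S n d})
        (Sum.elim (fun _ => ∅) fun o => {.var (.inl o)}) x)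

theorem tmLevel_countable {S : Set (Sym L Obj)} (hS : S.Countable) (n d : ℕ) :
    (tmLevel S n d).Countable := by
  induction d with
  | zero => exact Set.countable_empty
  | succ d ih =>
    refine (Set.countable_range _).union (hS.biUnion fun x _ => ?_)
    rcases x with f | P | o
    · exact (Set.countable_pi fun _ => ih).image _
    · exact Set.countable_empty
    · exact Set.countable_singleton _

/-- Membership from some level onwards, instead of at one level, lets the levels of several subterms
be combined by a maximum without a proof that the levels increase. -/
theorem Tm.Over.exists_level {S : Set (Sym L Obj)} {n : ℕ} {t : Tm L Obj n} (h : Tm.Over S t) :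
    ∃ d₀, ∀ d ≥ d₀, t ∈ tmLevel S n d := by
  induction t with
  | var x =>
    refine ⟨1, fun d hd => ?_⟩
    obtain ⟨d, rfl⟩ := Nat.exists_eq_add_of_le' hd
    rcases x with o | i
    · exact Or.inr (Set.mem_biUnion h rfl)
    · exact Or.inl ⟨i, rfl⟩
  | func f ts ih =>
    choose e he using fun i => ih i (h.2 i)
    refine ⟨Finset.univ.sup e + 1, fun d hd => ?_⟩
    obtain ⟨d, rfl⟩ := Nat.exists_eq_add_of_le' (Nat.one_le_of_lt hd)
    refine Or.inr (Set.mem_biUnion h.1 ⟨ts, fun i => he i _ ?_, rfl⟩)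
    have := Finset.le_sup (f := e) (Finset.mem_univ i)
    omega

theorem countable_tm {S : Set (Sym L Obj)} (hS : S.Countable) (n : ℕ) :
    {t : Tm L Obj n | Tm.Over S t}.Countable := by
  refine (Set.countable_iUnion (tmLevel_countable hS n)).mono fun t ht => ?_
  obtain ⟨d, hd⟩ := Tm.Over.exists_level ht
  exact Set.mem_iUnion.2 ⟨d, hd d le_rfl⟩

/-- Formulas over `S` of height less than `d`. -/
def formLevel (S : Set (Sym L Obj)) : ℕ → ∀ n : ℕ, Set (Form L Obj n)
  | 0, _ => ∅
  | d + 1, n => {.top} ∪ {.bot} ∪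
      Set.image2 .eq {t : Tm L Obj n | Tm.Over S t} {t : Tm L Obj n | Tm.Over S t} ∪
      (⋃ x ∈ S, Sum.elim (fun _ => ∅) (Sum.elim
        (fun P => (fun ts => .rel P ts) '' {ts : Fin P.1 → Tm L Obj n | ∀ i, Tm.Over S (ts i)})
        (fun _ => ∅)) x) ∪
      Form.neg '' formLevel S d n ∪
      Set.image2 .and (formLevel S d n) (formLevel S d n) ∪
      Set.image2 .or (formLevel S d n) (formLevel S d n) ∪
      Set.image2 .imp (formLevel S d n) (formLevel S d n) ∪
      Set.image2 .iff (formLevel S d n) (formLevel S d n) ∪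
      Form.all '' formLevel S d (n + 1) ∪
      Form.ex '' formLevel S d (n + 1)

theorem formLevel_countable {S : Set (Sym L Obj)} (hS : S.Countable) (n d : ℕ) :
    (formLevel S d n).Countable := by
  induction d generalizing n with
  | zero => exact Set.countable_empty
  | succ d ih =>
    have hT := countable_tm hS n
    refine ((((((((((Set.countable_singleton _).union (Set.countable_singleton _)).union
      (hT.image2 hT _)).union (hS.biUnion fun x _ => ?_)).union ((ih n).image _)).union
      ((ih n).image2 (ih n) _)).union ((ih n).image2 (ih n) _)).union
      ((ih n).image2 (ih n) _)).union ((ih n).image2 (ih n) _)).union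
      ((ih (n + 1)).image _)).union ((ih (n + 1)).image _)
    rcases x with f | P | o
    · exact Set.countable_empty
    · exact (Set.countable_pi fun _ => hT).image _
    · exact Set.countable_empty

theorem Form.Over.exists_level {S : Set (Sym L Obj)} {n : ℕ} {φ : Form L Obj n} (h : φ.Over S) :
    ∃ d₀, ∀ d ≥ d₀, φ ∈ formLevel S d n := by
  induction φ with
  | top | bot =>
    refine ⟨1, fun d hd => ?_⟩
    obtain ⟨d, rfl⟩ := Nat.exists_eq_add_of_le' hd
    simp [formLevel]
  | eq t s =>
    refine ⟨1, fun d hd => ?_⟩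
    obtain ⟨d, rfl⟩ := Nat.exists_eq_add_of_le' hd
    have := h.1
    have := h.2
    simp [formLevel, *]
  | rel P ts =>
    refine ⟨1, fun d hd => ?_⟩
    obtain ⟨d, rfl⟩ := Nat.exists_eq_add_of_le' hd
    have : Form.rel P ts ∈ (⋃ x ∈ S, Sum.elim (fun _ => ∅) (Sum.elim
        (fun P => (fun ts => Form.rel P ts) '' {ts : Fin P.1 → Tm L Obj _ | ∀ i, Tm.Over S (ts i)})
        (fun _ => ∅)) x) := Set.mem_biUnion h.1 ⟨ts, h.2, rfl⟩
    simp only [formLevel, Set.mem_union]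
    tauto
  | neg φ ih | all φ ih | ex φ ih =>
    obtain ⟨d₀, h₀⟩ := ih h
    refine ⟨d₀ + 1, fun d hd => ?_⟩
    obtain ⟨d, rfl⟩ := Nat.exists_eq_add_of_le' (Nat.one_le_of_lt hd)
    have := h₀ d (by omega)
    simp [formLevel, this]
  | and φ ψ ih₁ ih₂ | or φ ψ ih₁ ih₂ | imp φ ψ ih₁ ih₂ | iff φ ψ ih₁ ih₂ =>
    obtain ⟨d₁, h₁⟩ := ih₁ h.1
    obtain ⟨d₂, h₂⟩ := ih₂ h.2
    refine ⟨max d₁ d₂ + 1, fun d hd => ?_⟩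
    obtain ⟨d, rfl⟩ := Nat.exists_eq_add_of_le' (Nat.one_le_of_lt hd)
    have h₁ := h₁ d (by omega)
    have h₂ := h₂ d (by omega)
    simp [formLevel, h₁, h₂]

theorem countable_form {S : Set (Sym L Obj)} (hS : S.Countable) (n : ℕ) :
    {φ : Form L Obj n | φ.Over S}.Countable := by
  refine (Set.countable_iUnion (formLevel_countable hS n)).mono fun φ hφ => ?_
  obtain ⟨d, hd⟩ := Form.Over.exists_level hφ
  exact Set.mem_iUnion.2 ⟨d, hd d le_rfl⟩

end FOID
-- The calculus restricted to first-order formulas beside the fixed definitions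
namespace FOID

open FirstOrder Language

variable {L : FirstOrder.Language.{u, v}} {Obj : Type w}

/-! ### Renaming a context -/

theorem relabel_subst_fill {m : ℕ} (t : Tm L Obj 0) (g : Fin 0 → Fin m)
    (ts : Fin m → Tm L Obj 0) :
    Term.subst (t.relabel (Sum.map id g)) (Subst.fill ts) = t := by
  rw [term_relabel_subst]
  exact Tm.subst_eq_self ⟨fun _ _ => rfl, fun i => i.elim0⟩

theorem Subst.two_of_ne [DecidableEq Obj] {o x y : Obj} (hx : o ≠ x) (hy : o ≠ y)
    (a b : Tm L Obj 0) : Subst.two x a y b (.inl o) = Tm.obj o := by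
  change Function.update (Function.update Tm.obj x a) y b o = _
  rw [Function.update_of_ne hy, Function.update_of_ne hx]

theorem Subst.two_left [DecidableEq Obj] {x y : Obj} (hxy : x ≠ y) (a b : Tm L Obj 0) :
    Subst.two x a y b (.inl x) = a := by
  change Function.update (Function.update Tm.obj x a) y b x = _
  rw [Function.update_of_ne hxy, Function.update_self]

theorem Subst.two_right [DecidableEq Obj] (x y : Obj) (a b : Tm L Obj 0) :
    Subst.two x a y b (.inl y) = b :=
  Function.update_self ..

/-- Freshness of `x` and `y` makes the substitution act trivially on `ψ` itself, so that it affects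
only the two terms put into the open places. -/
theorem Form.subst_two [DecidableEq Obj] {ψ : Form L Obj 2} {x y : Obj} (hxy : x ≠ y) (hx : x ∉ ψ.free)
    (hy : y ∉ ψ.free) (a b : Tm L Obj 0) :
    (ψ.subst (Subst.fill ![Tm.obj x, Tm.obj y])).subst (Subst.two x a y b) =
      ψ.subst (Subst.fill ![a, b]) := by
  have hfix : ψ.subst ((Subst.two x a y b).lift 2) = ψ := by
    refine Form.subst_eq_self ⟨fun o ho => ?_, fun i => ?_⟩
    · have h₁ : o ≠ x := fun h => hx (h ▸ ho)
      have h₂ : o ≠ y := fun h => hy (h ▸ ho)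
      change (Subst.two x a y b (.inl o)).relabel _ = _
      rw [Subst.two_of_ne h₁ h₂ a b]
      rfl
    · have := (Subst.two x a y b).lift_natAdd 2 i
      rwa [show Fin.natAdd 0 i = i from Fin.ext (Nat.zero_add _)] at this
  conv_rhs => rw [← hfix]
  rw [Form.subst_subst, Form.subst_subst]
  congr 1
  funext z
  rcases z with o | i
  · exact (relabel_subst_fill _ _ _).symm
  · fin_cases i
    · exact Subst.two_left hxy a b
    · exact Subst.two_right x y a b

theorem IDForm.subst_two_toID [DecidableEq Obj] {φ : Form L Obj 0} {x y : Obj} (hx : x ∉ φ.free)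
    (hy : y ∉ φ.free) (a b : Tm L Obj 0) : φ.toID.subst (Subst.two x a y b) = φ.toID := by
  rw [← Form.subst_toID]
  congr 1
  refine Form.subst_eq_self ⟨fun o ho => ?_, fun i => i.elim0⟩
  have h₁ : o ≠ x := fun h => hx (h ▸ ho)
  have h₂ : o ≠ y := fun h => hy (h ▸ ho)
  exact Subst.two_of_ne h₁ h₂ a b

/-! ### Cut-free provability of sequents with a fixed list of definitions -/

section

variable {n : ℕ}

/-- The sequent `A, Φ₁, …, Φₙ ⊢ B` has a cut-free proof. -/
def Prv [DecidableEq Obj] (Φ : Fin n → Defn L Obj 0) (A B : Set (Form L Obj 0)) : Prop :=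
  CutFreeProvable (antecedent A Φ) (succedent B)

theorem antecedent_insert (Φ : Fin n → Defn L Obj 0) (φ : Form L Obj 0) (A : Set (Form L Obj 0)) :
    antecedent (insert φ A) Φ = insert φ.toID (antecedent A Φ) := by
  simp [antecedent, Set.image_insert_eq, Set.insert_union]

theorem succedent_insert (φ : Form L Obj 0) (B : Set (Form L Obj 0)) :
    succedent (insert φ B) = insert φ.toID (succedent B) := by
  simp [succedent, Set.image_insert_eq]

theorem toID_mem_antecedent {Φ : Fin n → Defn L Obj 0} {φ : Form L Obj 0}
    {A : Set (Form L Obj 0)} (h : φ ∈ A) : φ.toID ∈ antecedent A Φ :=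
  Or.inl ⟨φ, h, rfl⟩

theorem toID_mem_succedent {φ : Form L Obj 0} {B : Set (Form L Obj 0)} (h : φ ∈ B) :
    φ.toID ∈ succedent B :=
  ⟨φ, h, rfl⟩

theorem insert_defn_antecedent (Φ : Fin n → Defn L Obj 0) (A : Set (Form L Obj 0)) (i : Fin n) :
    insert (.defn (Φ i)) (antecedent A Φ) = antecedent A Φ :=
  Set.insert_eq_of_mem (Or.inr ⟨i, rfl⟩)

theorem antecedent_mono {Φ : Fin n → Defn L Obj 0} {A A' : Set (Form L Obj 0)} (h : A ⊆ A') :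
    antecedent A Φ ⊆ antecedent A' Φ :=
  Set.union_subset_union_left _ (Set.image_mono h)

theorem freeIn_antecedent_finite {Φ : Fin n → Defn L Obj 0} {A : Set (Form L Obj 0)}
    (hA : A.Finite) : (freeIn (antecedent A Φ)).Finite := by
  refine ((hA.image _).union (Set.finite_range _)).biUnion ?_
  rintro _ (⟨φ, -, rfl⟩ | ⟨i, rfl⟩)
  · rw [Form.free_toID]
    exact φ.free_finite
  · exact (Φ i).free_finite

theorem freeIn_succedent_finite {B : Set (Form L Obj 0)} (hB : B.Finite) :
    (freeIn (succedent B)).Finite := by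
  refine (hB.image _).biUnion ?_
  rintro _ ⟨φ, -, rfl⟩
  rw [Form.free_toID]
  exact φ.free_finite

theorem substSet_eq_self {Γ : Set (IDForm L Obj 0)} {σ : Subst L Obj 0 0}
    (h : ∀ φ ∈ Γ, φ.subst σ = φ) : substSet Γ σ = Γ := by
  rw [substSet, Set.image_congr h, Set.image_id']

theorem substSet_two_antecedent [DecidableEq Obj] {Φ : Fin n → Defn L Obj 0} {A : Set (Form L Obj 0)} {x y : Obj}
    (hx : x ∉ freeIn (antecedent A Φ)) (hy : y ∉ freeIn (antecedent A Φ)) (a b : Tm L Obj 0) :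
    substSet (antecedent A Φ) (Subst.two x a y b) = antecedent A Φ := by
  refine substSet_eq_self fun φ hφ => ?_
  have hx : x ∉ φ.free := fun h => hx (Set.mem_biUnion hφ h)
  have hy : y ∉ φ.free := fun h => hy (Set.mem_biUnion hφ h)
  rcases hφ with ⟨φ, -, rfl⟩ | ⟨i, rfl⟩
  · rw [Form.free_toID] at hx hy
    exact IDForm.subst_two_toID hx hy a b
  · simp only [IDForm.subst, IDForm.defn.injEq]
    refine Defn.subst_eq_self ⟨fun o ho => ?_, fun i => i.elim0⟩
    have h₁ : o ≠ x := fun h => hx (h ▸ ho)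
    have h₂ : o ≠ y := fun h => hy (h ▸ ho)
    exact Subst.two_of_ne h₁ h₂ a b

theorem substSet_two_succedent [DecidableEq Obj] {B : Set (Form L Obj 0)} {x y : Obj}
    (hx : x ∉ freeIn (succedent B)) (hy : y ∉ freeIn (succedent B)) (a b : Tm L Obj 0) :
    substSet (succedent B) (Subst.two x a y b) = succedent B := by
  refine substSet_eq_self fun φ hφ => ?_
  have hx : x ∉ φ.free := fun h => hx (Set.mem_biUnion hφ h)
  have hy : y ∉ φ.free := fun h => hy (Set.mem_biUnion hφ h)
  obtain ⟨φ, -, rfl⟩ := hφ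
  rw [Form.free_toID] at hx hy
  exact IDForm.subst_two_toID hx hy a b

theorem substSet_insert (Γ : Set (IDForm L Obj 0)) (φ : IDForm L Obj 0) (σ : Subst L Obj 0 0) :
    substSet (insert φ Γ) σ = insert (φ.subst σ) (substSet Γ σ) :=
  Set.image_insert_eq

theorem exists_fresh_pair [Infinite Obj] {X : Set Obj} (hX : X.Finite) :
    ∃ x y, x ≠ y ∧ x ∉ X ∧ y ∉ X := by
  obtain ⟨x, hx⟩ := hX.exists_notMem
  obtain ⟨y, hy⟩ := (hX.insert x).exists_notMem
  rw [Set.mem_insert_iff, not_or] at hy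
  exact ⟨x, y, Ne.symm hy.1, hx, hy.2⟩

namespace Prv

variable [DecidableEq Obj] {Φ : Fin n → Defn L Obj 0} {A A' B B' : Set (Form L Obj 0)}

/-- Sequents are sets, so inserting a formula that is already present changes nothing. The rules
below can therefore keep their principal formula in the premises, which is the form needed to read
them backwards. -/
theorem of_mem_left {φ : Form L Obj 0} (hm : φ ∈ A)
    (h : Prov False (insert φ.toID (antecedent A Φ)) (succedent B)) : Prv Φ A B := by
  rwa [Set.insert_eq_of_mem (toID_mem_antecedent hm)] at h

theorem of_mem_right {φ : Form L Obj 0} (hm : φ ∈ B)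
    (h : Prov False (antecedent A Φ) (insert φ.toID (succedent B))) : Prv Φ A B := by
  rwa [Set.insert_eq_of_mem (toID_mem_succedent hm)] at h

theorem mono (h : Prv Φ A B) (hA : A ⊆ A') (hB : B ⊆ B') : Prv Φ A' B' :=
  Prov.wk (antecedent_mono hA) (Set.image_mono hB) h

theorem ax {φ : Form L Obj 0} (hA : φ ∈ A) (hB : φ ∈ B) : Prv Φ A B :=
  Prov.ax (Or.inl ⟨φ.toID, toID_mem_antecedent hA, toID_mem_succedent hB⟩)

theorem botL (h : .bot ∈ A) : Prv Φ A B :=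
  Prov.ax (Or.inr (Or.inl (toID_mem_antecedent h)))

theorem topR (h : .top ∈ B) : Prv Φ A B :=
  Prov.ax (Or.inr (Or.inr (toID_mem_succedent h)))

theorem eqR {t : Tm L Obj 0} (h : .eq t t ∈ B) : Prv Φ A B := by
  have := Prov.eqR (cut := False) (Γ := antecedent A Φ) (Δ := succedent B) t
  exact of_mem_right h this

theorem negL {φ : Form L Obj 0} (hm : φ.neg ∈ A) (h : Prv Φ A (insert φ B)) : Prv Φ A B := by
  rw [Prv, succedent_insert] at h
  have := Prov.negL _ h
  exact of_mem_left hm this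

theorem negR {φ : Form L Obj 0} (hm : φ.neg ∈ B) (h : Prv Φ (insert φ A) B) : Prv Φ A B := by
  rw [Prv, antecedent_insert] at h
  have := Prov.negR _ h
  exact of_mem_right hm this

theorem orL {φ ψ : Form L Obj 0} (hm : φ.or ψ ∈ A) (h₁ : Prv Φ (insert φ A) B)
    (h₂ : Prv Φ (insert ψ A) B) : Prv Φ A B := by
  rw [Prv, antecedent_insert] at h₁ h₂
  have := Prov.orL _ _ h₁ h₂
  exact of_mem_left hm this

theorem orR {φ ψ : Form L Obj 0} (hm : φ.or ψ ∈ B) (h : Prv Φ A (insert φ (insert ψ B))) :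
    Prv Φ A B := by
  rw [Prv, succedent_insert, succedent_insert] at h
  have := Prov.orR _ _ h
  exact of_mem_right hm this

theorem andL {φ ψ : Form L Obj 0} (hm : φ.and ψ ∈ A) (h : Prv Φ (insert φ (insert ψ A)) B) :
    Prv Φ A B := by
  rw [Prv, antecedent_insert, antecedent_insert] at h
  have := Prov.andL _ _ h
  exact of_mem_left hm this

theorem andR {φ ψ : Form L Obj 0} (hm : φ.and ψ ∈ B) (h₁ : Prv Φ A (insert φ B))
    (h₂ : Prv Φ A (insert ψ B)) : Prv Φ A B := by
  rw [Prv, succedent_insert] at h₁ h₂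
  have := Prov.andR _ _ h₁ h₂
  exact of_mem_right hm this

theorem impL {φ ψ : Form L Obj 0} (hm : φ.imp ψ ∈ A) (h₁ : Prv Φ A (insert φ B))
    (h₂ : Prv Φ (insert ψ A) B) : Prv Φ A B := by
  rw [Prv, succedent_insert] at h₁
  rw [Prv, antecedent_insert] at h₂
  have := Prov.impL _ _ h₁ h₂
  exact of_mem_left hm this

theorem impR {φ ψ : Form L Obj 0} (hm : φ.imp ψ ∈ B) (h : Prv Φ (insert φ A) (insert ψ B)) :
    Prv Φ A B := by
  rw [Prv, succedent_insert, antecedent_insert] at h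
  have := Prov.impR _ _ h
  exact of_mem_right hm this

theorem iffL {φ ψ : Form L Obj 0} (hm : φ.iff ψ ∈ A) (h₁ : Prv Φ A (insert φ (insert ψ B)))
    (h₂ : Prv Φ (insert φ (insert ψ A)) B) : Prv Φ A B := by
  rw [Prv, succedent_insert, succedent_insert] at h₁
  rw [Prv, antecedent_insert, antecedent_insert] at h₂
  have := Prov.iffL _ _ h₁ h₂
  exact of_mem_left hm this

theorem iffR {φ ψ : Form L Obj 0} (hm : φ.iff ψ ∈ B) (h₁ : Prv Φ (insert φ A) (insert ψ B))
    (h₂ : Prv Φ (insert ψ A) (insert φ B)) : Prv Φ A B := by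
  rw [Prv, succedent_insert, antecedent_insert] at h₁ h₂
  have := Prov.iffR _ _ h₁ h₂
  exact of_mem_right hm this

theorem allL {φ : Form L Obj 1} (hm : φ.all ∈ A) (t : Tm L Obj 0)
    (h : Prv Φ (insert (φ.subst (Subst.fill fun _ => t)) A) B) : Prv Φ A B := by
  rw [Prv, antecedent_insert, Form.subst_toID] at h
  have := Prov.allL _ t h
  exact of_mem_left hm this

theorem exR {φ : Form L Obj 1} (hm : φ.ex ∈ B) (t : Tm L Obj 0)
    (h : Prv Φ A (insert (φ.subst (Subst.fill fun _ => t)) B)) : Prv Φ A B := by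
  rw [Prv, succedent_insert, Form.subst_toID] at h
  have := Prov.exR _ t h
  exact of_mem_right hm this

theorem allR {φ : Form L Obj 1} (hm : φ.all ∈ B) (x : Obj)
    (hx : x ∉ freeIn (antecedent A Φ) ∪ freeIn (succedent B) ∪ φ.free)
    (h : Prv Φ A (insert (φ.subst (Subst.fill fun _ => Tm.obj x)) B)) : Prv Φ A B := by
  rw [Prv, succedent_insert, Form.subst_toID] at h
  rw [← Form.free_toID] at hx
  have := Prov.allR _ x hx h
  exact of_mem_right hm this

theorem exL {φ : Form L Obj 1} (hm : φ.ex ∈ A) (x : Obj)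
    (hx : x ∉ freeIn (antecedent A Φ) ∪ freeIn (succedent B) ∪ φ.free)
    (h : Prv Φ (insert (φ.subst (Subst.fill fun _ => Tm.obj x)) A) B) : Prv Φ A B := by
  rw [Prv, antecedent_insert, Form.subst_toID] at h
  rw [← Form.free_toID] at hx
  have := Prov.exL _ x hx h
  exact of_mem_left hm this

/-- The rule (=L) rewrites the whole sequent. Marking the places to be exchanged by two fresh
symbols confines the rewriting to one formula, since the rest of the sequent is fixed by the
substitution. Finiteness of the two sides supplies the fresh symbols. -/
theorem eq_swap_left [Infinite Obj] (hA : A.Finite) (hB : B.Finite) {t s : Tm L Obj 0}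
    (he : .eq t s ∈ A) (ψ : Form L Obj 2) (hm : ψ.subst (Subst.fill ![t, s]) ∈ A)
    (h : Prv Φ (insert (ψ.subst (Subst.fill ![s, t])) A) B) : Prv Φ A B := by
  obtain ⟨x, y, hxy, hx, hy⟩ := exists_fresh_pair
    (((freeIn_antecedent_finite (Φ := Φ) hA).union (freeIn_succedent_finite hB)).union
      ψ.free_finite)
  simp only [Set.mem_union, not_or] at hx hy
  have key := Prov.eqL (cut := False)
    (Γ := insert (ψ.subst (Subst.fill ![Tm.obj x, Tm.obj y])).toID (antecedent A Φ))
    (Δ := succedent B) x y hxy t s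
  simp only [substSet_insert, substSet_two_antecedent hx.1.1 hy.1.1,
    substSet_two_succedent hx.1.2 hy.1.2, ← Form.subst_toID, Form.subst_two hxy hx.2 hy.2] at key
  simp only [← antecedent_insert] at key
  have := key h
  rw [Set.insert_eq_of_mem hm] at this
  exact of_mem_left he this

theorem eq_swap_right [Infinite Obj] (hA : A.Finite) (hB : B.Finite) {t s : Tm L Obj 0}
    (he : .eq t s ∈ A) (ψ : Form L Obj 2) (hm : ψ.subst (Subst.fill ![t, s]) ∈ B)
    (h : Prv Φ A (insert (ψ.subst (Subst.fill ![s, t])) B)) : Prv Φ A B := by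
  obtain ⟨x, y, hxy, hx, hy⟩ := exists_fresh_pair
    (((freeIn_antecedent_finite (Φ := Φ) hA).union (freeIn_succedent_finite hB)).union
      ψ.free_finite)
  simp only [Set.mem_union, not_or] at hx hy
  have key := Prov.eqL (cut := False) (Γ := antecedent A Φ)
    (Δ := insert (ψ.subst (Subst.fill ![Tm.obj x, Tm.obj y])).toID (succedent B)) x y hxy t s
  simp only [substSet_insert, substSet_two_antecedent hx.1.1 hy.1.1,
    substSet_two_succedent hx.1.2 hy.1.2, ← Form.subst_toID, Form.subst_two hxy hx.2 hy.2] at key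
  simp only [← succedent_insert] at key
  have := key h
  rw [Set.insert_eq_of_mem hm] at this
  exact of_mem_left he this

theorem defR {i : Fin n} {r : Rule L Obj 0} (hr : r ∈ (Φ i).rules)
    (s : Fin (0 + r.k) → Tm L Obj 0)
    (hm : .rel r.head (fun j => Term.subst (r.args j) (Subst.fill s)) ∈ B)
    (h : Prv Φ A (insert (r.body.subst (Subst.fill s)) B)) : Prv Φ A B := by
  rw [Prv, succedent_insert, ← insert_defn_antecedent Φ A i] at h
  have := Prov.defR (Φ i) r hr s h
  rw [insert_defn_antecedent] at this
  exact of_mem_right hm this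

theorem defL {i : Fin n} {P : Pred L} (hP : P ∈ (Φ i).defined) (ts : Fin P.1 → Tm L Obj 0)
    (hm : .rel P ts ∈ A) (F : ∀ Q : Pred L, Form L Obj Q.1)
    (y : ∀ r : Rule L Obj 0, Fin (0 + r.k) → Obj) (hinj : ∀ r, Function.Injective (y r))
    (hctx : ∀ r j, y r j ∉ freeIn (antecedent A Φ) ∪ freeIn (succedent B))
    (hhyp : ∀ r j, ∀ Q ∈ (Φ i).defined, y r j ∉ (F Q).free)
    (hminor : ∀ r ∈ (Φ i).rules,
      Prv Φ (insert ((r.body.replace (Φ i).defined F true).subst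
          (Subst.fill fun j => Tm.obj (y r j))) A)
        (insert ((F r.head).subst (Subst.fill fun l => Term.subst (r.args l)
          (Subst.fill fun j => Tm.obj (y r j)))) B))
    (hmajor : Prv Φ (insert ((F P).subst (Subst.fill ts)) A) B) : Prv Φ A B := by
  -- The set `Π` of the rule is always taken to be all of `Def(Φ i)`.
  have := Prov.defL (cut := False) (Γ := antecedent A Φ) (Δ := succedent B) (Φ i) (Φ i).defined
    subset_rfl F P hP ts y (fun r _ => hinj r) (fun r _ j => ?_) (fun r _ => hhyp r)
    (fun r hr _ => ?_) ?_
  · rw [insert_defn_antecedent] at this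
    exact of_mem_left hm this
  · rw [Set.mem_union, not_or]
    exact ⟨hctx r j, fun h => hctx r j (Or.inl (Set.mem_biUnion (Or.inr ⟨i, rfl⟩) h))⟩
  · rw [insert_defn_antecedent, ← antecedent_insert, ← succedent_insert]
    exact hminor r hr
  · rw [insert_defn_antecedent, ← antecedent_insert]
    exact hmajor

end Prv

end

end FOID
-- Construction of a maximal unprovable pair with witnesses
namespace FOID

open FirstOrder Language

variable {L : FirstOrder.Language.{u, v}} {Obj : Type w}

/-! ### Generic sequents -/

/-- A form of the Rasiowa–Sikorski lemma: an ideal that meets every request of a countable set.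
A request is a pair of a condition that is preserved by extension and of a condition that can be
achieved by extension once the first one holds. -/
theorem exists_generic_ideal {P : Type*} [Preorder P] (p : P) {R : Set ((P → Prop) × (P → Prop))}
    (hR : R.Countable) (hmono : ∀ r ∈ R, ∀ p q, p ≤ q → r.1 p → r.1 q)
    (hext : ∀ r ∈ R, ∀ p, r.1 p → ∃ q ≥ p, r.2 q) :
    ∃ I : Order.Ideal P, p ∈ I ∧ ∀ r ∈ R, ∀ p ∈ I, r.1 p → ∃ q ∈ I, r.2 q := by
  have := hR.toEncodable
  let 𝒟 : R → Order.Cofinal P := fun r =>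
    -- Once no extension satisfies the first half of the request, the request is void; admitting
    -- this alternative makes the set cofinal. For a member of the ideal that satisfies the first
    -- half the alternative is impossible, because the two conditions have a common extension.
    { carrier := {p | r.1.2 p ∨ ∀ q ≥ p, ¬ r.1.1 q}
      isCofinal := fun p => by
        by_cases h : ∃ q ≥ p, r.1.1 q
        · obtain ⟨q, hpq, hq⟩ := h
          obtain ⟨q', hqq', hq'⟩ := hext r.1 r.2 q hq
          exact ⟨q', Or.inl hq', hpq.trans hqq'⟩
        · push Not at h
          exact ⟨p, Or.inr h, le_rfl⟩ }
  refine ⟨Order.idealOfCofinals p 𝒟, Order.mem_idealOfCofinals p 𝒟, fun r hr q hq hrq => ?_⟩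
  obtain ⟨x, hx, hxI⟩ := Order.cofinal_meets_idealOfCofinals p 𝒟 ⟨r, hr⟩
  rcases hx with hx | hx
  · exact ⟨x, hxI, hx⟩
  · obtain ⟨z, -, hqz, hxz⟩ := (Order.idealOfCofinals p 𝒟).directed q hq x hxI
    exact absurd (hmono r hr q z hqz hrq) (hx z hxz)

/-- Extends a family of induction hypotheses for the defined predicates to all predicates. -/
noncomputable def Defn.extend (Φ : Defn L Obj 0) (F : ∀ Q : Φ.defined, Form L Obj Q.1.1) (Q : Pred L) :
    Form L Obj Q.1 :=
  open Classical in if h : Q ∈ Φ.defined then F ⟨Q, h⟩ else .bot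

theorem Defn.extend_of_mem (Φ : Defn L Obj 0) (F : ∀ Q : Φ.defined, Form L Obj Q.1.1) {Q : Pred L}
    (h : Q ∈ Φ.defined) : Φ.extend F Q = F ⟨Q, h⟩ :=
  dif_pos h

theorem exists_seq_of_infinite {X Y : Set Obj} (hX : X.Infinite) (hY : Y.Finite) :
    ∃ e : ℕ → Obj, Function.Injective e ∧ ∀ i, e i ∈ X ∧ e i ∉ Y := by
  have := (hX.sdiff hY).to_subtype
  exact ⟨fun i => (Infinite.natEmbedding (X \ Y : Set Obj) i).1,
    Subtype.val_injective.comp (Infinite.natEmbedding _).injective,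
    fun i => (Infinite.natEmbedding (X \ Y : Set Obj) i).2⟩

variable [DecidableEq Obj] {n : ℕ}

/-- The sequent `A ⊢ B` is finitely unprovable without cuts in the presence of the definitions
`Φ`; it is maximal with respect to the formulas over the set `S` of symbols, and it contains
witnesses over `S` for the rules with eigenvariables. -/
structure Generic (S : Set (Sym L Obj)) (Φ : Fin n → Defn L Obj 0) (A B : Set (Form L Obj 0)) :
    Prop where
  not_prv : ∀ A' ⊆ A, ∀ B' ⊆ B, A'.Finite → B'.Finite → ¬ Prv Φ A' B'
  max_left : ∀ φ : Form L Obj 0, φ.Over S → φ ∉ A →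
    ∃ A' ⊆ A, ∃ B' ⊆ B, A'.Finite ∧ B'.Finite ∧ Prv Φ (insert φ A') B'
  max_right : ∀ φ : Form L Obj 0, φ.Over S → φ ∉ B →
    ∃ A' ⊆ A, ∃ B' ⊆ B, A'.Finite ∧ B'.Finite ∧ Prv Φ A' (insert φ B')
  ex_left : ∀ φ : Form L Obj 1, φ.Over S → φ.ex ∈ A →
    ∃ x, .inr (.inr x) ∈ S ∧ φ.subst (Subst.fill fun _ => Tm.obj x) ∈ A
  all_right : ∀ φ : Form L Obj 1, φ.Over S → φ.all ∈ B →
    ∃ x, .inr (.inr x) ∈ S ∧ φ.subst (Subst.fill fun _ => Tm.obj x) ∈ B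
  defn_left : ∀ (i : Fin n) (P : Pred L), P ∈ (Φ i).defined → ∀ ts : Fin P.1 → Tm L Obj 0,
    (∀ j, Tm.Over S (ts j)) → ∀ F : ∀ Q : (Φ i).defined, Form L Obj Q.1.1, (∀ Q, (F Q).Over S) →
    .rel P ts ∈ A → ((Φ i).extend F P).subst (Subst.fill ts) ∈ A ∨
      ∃ r ∈ (Φ i).rules, ∃ s : Fin (0 + r.k) → Tm L Obj 0, (∀ j, Tm.Over S (s j)) ∧
        (r.body.replace (Φ i).defined ((Φ i).extend F) true).subst (Subst.fill s) ∈ A ∧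
        ((Φ i).extend F r.head).subst (Subst.fill fun l =>
          Term.subst (r.args l) (Subst.fill s)) ∈ B

/-- The conditions are the finite unprovable pairs, ordered by inclusion, and `A` and `B` are the
unions along a generic ideal. Each rule read backwards shows that its request can be met: if every
extension that meets it were provable, the rule would prove the condition itself. -/
theorem exists_generic {S : Set (Sym L Obj)} (hS : S.Countable)
    (hSinf : {x : Obj | .inr (.inr x) ∈ S}.Infinite) {Φ : Fin n → Defn L Obj 0}
    {A₀ B₀ : Set (Form L Obj 0)} (hA₀ : A₀.Finite) (hB₀ : B₀.Finite) (h : ¬ Prv Φ A₀ B₀) :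
    ∃ A B, A₀ ⊆ A ∧ B₀ ⊆ B ∧ Generic S Φ A B := by
  let C := {p : Set (Form L Obj 0) × Set (Form L Obj 0) //
    p.1.Finite ∧ p.2.Finite ∧ ¬ Prv Φ p.1 p.2}
  have cF : ∀ m, Countable {φ : Form L Obj m // φ.Over S} := fun m =>
    (countable_form hS m).to_subtype
  have cT : Countable {t : Tm L Obj 0 // Tm.Over S t} := (countable_tm hS 0).to_subtype
  -- A definition has finitely many defined predicates, so the families of induction hypotheses over
  -- `S` form a countable set, although they are functions.
  have cD : ∀ i, Finite (Φ i).defined := fun i => (Φ i).defined_finite.to_subtype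
  -- Maximality cannot be requested as outright membership. A formula that makes the condition
  -- provable has to be left out, and then the finite pair that shows this is recorded.
  let maxL (φ : {φ : Form L Obj 0 // φ.Over S}) : (C → Prop) × (C → Prop) :=
    (fun _ => True, fun p => φ.1 ∈ p.1.1 ∨ Prv Φ (insert φ.1 p.1.1) p.1.2)
  let maxR (φ : {φ : Form L Obj 0 // φ.Over S}) : (C → Prop) × (C → Prop) :=
    (fun _ => True, fun p => φ.1 ∈ p.1.2 ∨ Prv Φ p.1.1 (insert φ.1 p.1.2))
  let exL (φ : {φ : Form L Obj 1 // φ.Over S}) : (C → Prop) × (C → Prop) :=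
    (fun p => φ.1.ex ∈ p.1.1,
      fun p => ∃ x, .inr (.inr x) ∈ S ∧ φ.1.subst (Subst.fill fun _ => Tm.obj x) ∈ p.1.1)
  let allR (φ : {φ : Form L Obj 1 // φ.Over S}) : (C → Prop) × (C → Prop) :=
    (fun p => φ.1.all ∈ p.1.2,
      fun p => ∃ x, .inr (.inr x) ∈ S ∧ φ.1.subst (Subst.fill fun _ => Tm.obj x) ∈ p.1.2)
  let F' (i : Fin n) (F : ∀ Q : (Φ i).defined, {φ : Form L Obj Q.1.1 // φ.Over S}) :=
    (Φ i).extend fun Q => (F Q).1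
  let defL (d : Σ i : Fin n, Σ P : (Φ i).defined, (Fin P.1.1 → {t : Tm L Obj 0 // Tm.Over S t}) ×
      (∀ Q : (Φ i).defined, {φ : Form L Obj Q.1.1 // φ.Over S})) : (C → Prop) × (C → Prop) :=
    (fun p => .rel d.2.1.1 (fun j => (d.2.2.1 j).1) ∈ p.1.1,
      fun p => (F' d.1 d.2.2.2 d.2.1.1).subst (Subst.fill fun j => (d.2.2.1 j).1) ∈ p.1.1 ∨
      ∃ r ∈ (Φ d.1).rules, ∃ s : Fin (0 + r.k) → Tm L Obj 0, (∀ j, Tm.Over S (s j)) ∧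
        (r.body.replace (Φ d.1).defined (F' d.1 d.2.2.2) true).subst (Subst.fill s) ∈ p.1.1 ∧
        (F' d.1 d.2.2.2 r.head).subst (Subst.fill fun l =>
          Term.subst (r.args l) (Subst.fill s)) ∈ p.1.2)
  let R := Set.range maxL ∪ Set.range maxR ∪ Set.range exL ∪ Set.range allR ∪ Set.range defL
  have hR : R.Countable := by
    refine ((((Set.countable_range _).union (Set.countable_range _)).union
      (Set.countable_range _)).union (Set.countable_range _)).union (Set.countable_range _)
  have left {p : C} {φ : Form L Obj 0} (h : ¬ Prv Φ (insert φ p.1.1) p.1.2) :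
      ∃ q ≥ p, φ ∈ q.1.1 :=
    ⟨⟨(insert φ p.1.1, p.1.2), p.2.1.insert φ, p.2.2.1, h⟩,
      ⟨Set.subset_insert _ _, subset_rfl⟩, Set.mem_insert _ _⟩
  have right {p : C} {φ : Form L Obj 0} (h : ¬ Prv Φ p.1.1 (insert φ p.1.2)) :
      ∃ q ≥ p, φ ∈ q.1.2 :=
    ⟨⟨(p.1.1, insert φ p.1.2), p.2.1, p.2.2.1.insert φ, h⟩,
      ⟨subset_rfl, Set.subset_insert _ _⟩, Set.mem_insert _ _⟩
  have fresh (p : C) := (freeIn_antecedent_finite (Φ := Φ) p.2.1).union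
    (freeIn_succedent_finite p.2.2.1)
  have hmono : ∀ r ∈ R, ∀ p q, p ≤ q → r.1 p → r.1 q := by
    rintro _ ((((⟨φ, rfl⟩ | ⟨φ, rfl⟩) | ⟨φ, rfl⟩) | ⟨φ, rfl⟩) | ⟨d, rfl⟩) p q hpq hp
    · trivial
    · trivial
    · exact hpq.1 hp
    · exact hpq.2 hp
    · exact hpq.1 hp
  have hext : ∀ r ∈ R, ∀ p, r.1 p → ∃ q ≥ p, r.2 q := by
    rintro _ ((((⟨φ, rfl⟩ | ⟨φ, rfl⟩) | ⟨φ, rfl⟩) | ⟨φ, rfl⟩) | ⟨⟨i, P, ts, F⟩, rfl⟩) p hp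
    · by_cases h : Prv Φ (insert φ.1 p.1.1) p.1.2
      · exact ⟨p, le_rfl, Or.inr h⟩
      · exact (left h).imp fun q hq => ⟨hq.1, Or.inl hq.2⟩
    · by_cases h : Prv Φ p.1.1 (insert φ.1 p.1.2)
      · exact ⟨p, le_rfl, Or.inr h⟩
      · exact (right h).imp fun q hq => ⟨hq.1, Or.inl hq.2⟩
    -- Only finitely many object symbols are free in a condition, while `S` contains infinitely
    -- many, so an eigenvariable can be found inside `S`.
    · obtain ⟨x, hxS, hx⟩ := (hSinf.sdiff ((fresh p).union φ.1.free_finite)).nonempty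
      obtain ⟨q, hq, hm⟩ := left fun h => p.2.2.2 (Prv.exL hp x hx h)
      exact ⟨q, hq, x, hxS, hm⟩
    · obtain ⟨x, hxS, hx⟩ := (hSinf.sdiff ((fresh p).union φ.1.free_finite)).nonempty
      obtain ⟨q, hq, hm⟩ := right fun h => p.2.2.2 (Prv.allR hp x hx h)
      exact ⟨q, hq, x, hxS, hm⟩
    -- If no extension meets the request, then adding the formulas of any premise of (def L) makes
    -- the condition provable. So all premises are provable, and (def L) proves the condition.
    · by_contra! hcon
      obtain ⟨e, he, heX⟩ := exists_seq_of_infinite hSinf ((fresh p).union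
        ((Φ i).defined_finite.biUnion fun Q _ => (F' i F Q).free_finite))
      -- One sequence `e` of fresh symbols names the tuples of all rules: distinctness is required
      -- only within each tuple, since every minor premise is a sequent of its own.
      refine p.2.2.2 (Prv.defL P.2 (fun j => (ts j).1) hp (F' i F) (fun r j => e j)
        (fun r a b hab => Fin.ext (he hab)) (fun r j h => (heX j).2 (Or.inl h))
        (fun r j Q hQ h => (heX j).2 (Or.inr (Set.mem_biUnion hQ h))) (fun r hr => ?_) ?_)
      · by_contra h
        refine hcon ⟨(_, _), p.2.1.insert _, p.2.2.1.insert _, h⟩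
          ⟨Set.subset_insert _ _, Set.subset_insert _ _⟩
          (Or.inr ⟨r, hr, fun j => Tm.obj (e j), fun j => (heX j).1, Set.mem_insert _ _, Set.mem_insert _ _⟩)
      · by_contra h
        obtain ⟨q, hq, hm⟩ := left h
        exact hcon q hq (Or.inl hm)
  obtain ⟨I, hpI, hI⟩ := exists_generic_ideal (⟨(A₀, B₀), hA₀, hB₀, h⟩ : C) hR hmono hext
  -- The ideal is directed, so a finite part of the union already lies in a single condition. This
  -- transfers unprovability to all finite parts of the limit.
  have fin : ∀ X : Set (Form L Obj 0), X.Finite → X ⊆ (⋃ p ∈ I, p.1.1) →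
      ∃ p ∈ I, X ⊆ p.1.1 := by
    intro X hX
    induction X, hX using Set.Finite.induction_on with
    | empty => exact fun _ => ⟨_, hpI, Set.empty_subset _⟩
    | insert _ _ ih =>
      intro h
      rw [Set.insert_subset_iff] at h
      obtain ⟨p, hp, hpX⟩ := ih h.2
      obtain ⟨q, hq, hqX⟩ := Set.mem_iUnion₂.1 h.1
      obtain ⟨z, hz, hpz, hqz⟩ := I.directed p hp q hq
      exact ⟨z, hz, Set.insert_subset (hqz.1 hqX) (hpX.trans hpz.1)⟩
  have fin' : ∀ X : Set (Form L Obj 0), X.Finite → X ⊆ (⋃ p ∈ I, p.1.2) →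
      ∃ p ∈ I, X ⊆ p.1.2 := by
    intro X hX
    induction X, hX using Set.Finite.induction_on with
    | empty => exact fun _ => ⟨_, hpI, Set.empty_subset _⟩
    | insert _ _ ih =>
      intro h
      rw [Set.insert_subset_iff] at h
      obtain ⟨p, hp, hpX⟩ := ih h.2
      obtain ⟨q, hq, hqX⟩ := Set.mem_iUnion₂.1 h.1
      obtain ⟨z, hz, hpz, hqz⟩ := I.directed p hp q hq
      exact ⟨z, hz, Set.insert_subset (hqz.2 hqX) (hpX.trans hpz.2)⟩
  have memL {p : C} (hp : p ∈ I) : p.1.1 ⊆ ⋃ p ∈ I, p.1.1 :=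
    Set.subset_biUnion_of_mem (u := fun p : C => p.1.1) hp
  have memR {p : C} (hp : p ∈ I) : p.1.2 ⊆ ⋃ p ∈ I, p.1.2 :=
    Set.subset_biUnion_of_mem (u := fun p : C => p.1.2) hp
  refine ⟨⋃ p ∈ I, p.1.1, ⋃ p ∈ I, p.1.2, memL hpI, memR hpI, ?_, ?_, ?_, ?_, ?_, ?_⟩
  · intro A hA B hB hAf hBf hprv
    obtain ⟨p, hp, hpA⟩ := fin A hAf hA
    obtain ⟨q, hq, hqB⟩ := fin' B hBf hB
    obtain ⟨z, hz, hpz, hqz⟩ := I.directed p hp q hq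
    exact z.2.2.2 (hprv.mono (hpA.trans hpz.1) (hqB.trans hqz.2))
  · intro φ hφ hφA
    obtain ⟨p, hp, h | h⟩ := hI (maxL ⟨φ, hφ⟩) (Or.inl (Or.inl (Or.inl (Or.inl ⟨_, rfl⟩)))) _ hpI trivial
    · exact absurd (memL hp h) hφA
    · exact ⟨_, memL hp, _, memR hp, p.2.1, p.2.2.1, h⟩
  · intro φ hφ hφB
    obtain ⟨p, hp, h | h⟩ := hI (maxR ⟨φ, hφ⟩) (Or.inl (Or.inl (Or.inl (Or.inr ⟨_, rfl⟩)))) _ hpI trivial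
    · exact absurd (memR hp h) hφB
    · exact ⟨_, memL hp, _, memR hp, p.2.1, p.2.2.1, h⟩
  · intro φ hφ hφA
    obtain ⟨p, hp, hpA⟩ := Set.mem_iUnion₂.1 hφA
    obtain ⟨q, hq, x, hxS, hx⟩ := hI (exL ⟨φ, hφ⟩) (Or.inl (Or.inl (Or.inr ⟨_, rfl⟩))) p hp hpA
    exact ⟨x, hxS, memL hq hx⟩
  · intro φ hφ hφB
    obtain ⟨p, hp, hpB⟩ := Set.mem_iUnion₂.1 hφB
    obtain ⟨q, hq, x, hxS, hx⟩ := hI (allR ⟨φ, hφ⟩) (Or.inl (Or.inr ⟨_, rfl⟩)) p hp hpB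
    exact ⟨x, hxS, memR hq hx⟩
  · intro i P hP ts hts F hF hm
    obtain ⟨p, hp, hpA⟩ := Set.mem_iUnion₂.1 hm
    obtain ⟨q, hq, h | ⟨r, hr, s, hs, h₁, h₂⟩⟩ := hI
      (defL ⟨i, ⟨P, hP⟩, fun j => ⟨ts j, hts j⟩, fun Q => ⟨F Q, hF Q⟩⟩) (Or.inr ⟨_, rfl⟩) p hp hpA
    · exact Or.inl (memL hq h)
    · exact Or.inr ⟨r, hr, s, hs, memL hq h₁, memR hq h₂⟩

end FOID
-- Inference rules read backwards on a generic pair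
namespace FOID

open FirstOrder Language

variable {L : FirstOrder.Language.{u, v}} {Obj : Type w}

/-! ### Saturation properties of generic sequents -/

/-- The finite parts of a pair of sets of formulas. -/
def FinitePart (A B : Set (Form L Obj 0)) : Type (max u v w) :=
  {p : Set (Form L Obj 0) × Set (Form L Obj 0) // (p.1 ⊆ A ∧ p.1.Finite) ∧ p.2 ⊆ B ∧ p.2.Finite}

namespace FinitePart

variable {A B : Set (Form L Obj 0)}

instance : Preorder (FinitePart A B) := inferInstanceAs (Preorder (Subtype _))

instance : Nonempty (FinitePart A B) := ⟨⟨(∅, ∅), by simp⟩⟩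

instance : IsDirectedOrder (FinitePart A B) :=
  ⟨fun p q => ⟨⟨(p.1.1 ∪ q.1.1, p.1.2 ∪ q.1.2),
    ⟨Set.union_subset p.2.1.1 q.2.1.1, p.2.1.2.union q.2.1.2⟩,
    ⟨Set.union_subset p.2.2.1 q.2.2.1, p.2.2.2.union q.2.2.2⟩⟩,
    ⟨Set.subset_union_left, Set.subset_union_left⟩,
    ⟨Set.subset_union_right, Set.subset_union_right⟩⟩⟩

theorem eventually_mem_left {φ : Form L Obj 0} (h : φ ∈ A) :
    ∀ᶠ p : FinitePart A B in Filter.atTop, φ ∈ p.1.1 :=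
  (Filter.eventually_ge_atTop (⟨({φ}, ∅), by simpa using h⟩ : FinitePart A B)).mono
    fun _ hp => hp.1 rfl

theorem eventually_mem_right {φ : Form L Obj 0} (h : φ ∈ B) :
    ∀ᶠ p : FinitePart A B in Filter.atTop, φ ∈ p.1.2 :=
  (Filter.eventually_ge_atTop (⟨(∅, {φ}), by simpa using h⟩ : FinitePart A B)).mono
    fun _ hp => hp.2 rfl

end FinitePart

open FinitePart

variable [DecidableEq Obj] {n : ℕ} {S : Set (Sym L Obj)} {Φ : Fin n → Defn L Obj 0}
  {A B : Set (Form L Obj 0)}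

namespace Generic

/-- Finite parts form a directed set, so facts that hold for all large finite parts hold jointly for
one of them. If a closure property failed, every premise of the corresponding rule would be provable
for all large finite parts, hence so would the conclusion. -/
theorem false_of_eventually (hG : Generic S Φ A B)
    (h : ∀ᶠ p : FinitePart A B in Filter.atTop, Prv Φ p.1.1 p.1.2) : False := by
  obtain ⟨p, hp⟩ := h.exists
  exact hG.not_prv _ p.2.1.1 _ p.2.2.1 p.2.1.2 p.2.2.2 hp

theorem eventually_left (hG : Generic S Φ A B) {φ : Form L Obj 0} (hφ : φ.Over S) (h : φ ∉ A) :
    ∀ᶠ p : FinitePart A B in Filter.atTop, Prv Φ (insert φ p.1.1) p.1.2 := by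
  obtain ⟨A', hA', B', hB', hfA, hfB, h⟩ := hG.max_left φ hφ h
  exact (Filter.eventually_ge_atTop (⟨(A', B'), ⟨hA', hfA⟩, hB', hfB⟩ : FinitePart A B)).mono
    fun _ hp => h.mono (Set.insert_subset_insert hp.1) hp.2

theorem eventually_right (hG : Generic S Φ A B) {φ : Form L Obj 0} (hφ : φ.Over S) (h : φ ∉ B) :
    ∀ᶠ p : FinitePart A B in Filter.atTop, Prv Φ p.1.1 (insert φ p.1.2) := by
  obtain ⟨A', hA', B', hB', hfA, hfB, h⟩ := hG.max_right φ hφ h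
  exact (Filter.eventually_ge_atTop (⟨(A', B'), ⟨hA', hfA⟩, hB', hfB⟩ : FinitePart A B)).mono
    fun _ hp => h.mono hp.1 (Set.insert_subset_insert hp.2)

theorem notMem_right (hG : Generic S Φ A B) {φ : Form L Obj 0} (h : φ ∈ A) : φ ∉ B := fun h' =>
  hG.false_of_eventually <| by
    filter_upwards [eventually_mem_left h, eventually_mem_right h'] with p h h' using .ax h h'

theorem bot_notMem (hG : Generic S Φ A B) : .bot ∉ A := fun h =>
  hG.false_of_eventually <| (eventually_mem_left h).mono fun _ => .botL

theorem top_notMem (hG : Generic S Φ A B) : .top ∉ B := fun h =>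
  hG.false_of_eventually <| (eventually_mem_right h).mono fun _ => .topR

theorem eq_notMem (hG : Generic S Φ A B) (t : Tm L Obj 0) : .eq t t ∉ B := fun h =>
  hG.false_of_eventually <| (eventually_mem_right h).mono fun _ => .eqR

theorem neg_left (hG : Generic S Φ A B) {φ : Form L Obj 0} (hφ : φ.Over S) (h : φ.neg ∈ A) :
    φ ∈ B := by
  by_contra h'
  refine hG.false_of_eventually ?_
  filter_upwards [eventually_mem_left h, hG.eventually_right hφ h'] with p h h' using .negL h h'

theorem neg_right (hG : Generic S Φ A B) {φ : Form L Obj 0} (hφ : φ.Over S) (h : φ.neg ∈ B) :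
    φ ∈ A := by
  by_contra h'
  refine hG.false_of_eventually ?_
  filter_upwards [eventually_mem_right h, hG.eventually_left hφ h'] with p h h' using .negR h h'

variable {φ ψ : Form L Obj 0}

theorem or_left (hG : Generic S Φ A B) (hφ : φ.Over S) (hψ : ψ.Over S) (h : φ.or ψ ∈ A) :
    φ ∈ A ∨ ψ ∈ A := by
  by_contra! h'
  refine hG.false_of_eventually ?_
  filter_upwards [eventually_mem_left h, hG.eventually_left hφ h'.1, hG.eventually_left hψ h'.2]
    with p h h₁ h₂ using .orL h h₁ h₂

theorem or_right (hG : Generic S Φ A B) (hφ : φ.Over S) (hψ : ψ.Over S) (h : φ.or ψ ∈ B) :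
    φ ∈ B ∧ ψ ∈ B := by
  constructor <;> by_contra h' <;> refine hG.false_of_eventually ?_
  · filter_upwards [eventually_mem_right h, hG.eventually_right hφ h'] with p h h'
    exact .orR h (h'.mono subset_rfl (Set.insert_subset_insert (Set.subset_insert _ _)))
  · filter_upwards [eventually_mem_right h, hG.eventually_right hψ h'] with p h h'
    exact .orR h (h'.mono subset_rfl (Set.subset_insert _ _))

theorem and_left (hG : Generic S Φ A B) (hφ : φ.Over S) (hψ : ψ.Over S) (h : φ.and ψ ∈ A) :
    φ ∈ A ∧ ψ ∈ A := by
  constructor <;> by_contra h' <;> refine hG.false_of_eventually ?_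
  · filter_upwards [eventually_mem_left h, hG.eventually_left hφ h'] with p h h'
    exact .andL h (h'.mono (Set.insert_subset_insert (Set.subset_insert _ _)) subset_rfl)
  · filter_upwards [eventually_mem_left h, hG.eventually_left hψ h'] with p h h'
    exact .andL h (h'.mono (Set.subset_insert _ _) subset_rfl)

theorem and_right (hG : Generic S Φ A B) (hφ : φ.Over S) (hψ : ψ.Over S) (h : φ.and ψ ∈ B) :
    φ ∈ B ∨ ψ ∈ B := by
  by_contra! h'
  refine hG.false_of_eventually ?_
  filter_upwards [eventually_mem_right h, hG.eventually_right hφ h'.1, hG.eventually_right hψ h'.2]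
    with p h h₁ h₂ using .andR h h₁ h₂

theorem imp_left (hG : Generic S Φ A B) (hφ : φ.Over S) (hψ : ψ.Over S) (h : φ.imp ψ ∈ A) :
    φ ∈ B ∨ ψ ∈ A := by
  by_contra! h'
  refine hG.false_of_eventually ?_
  filter_upwards [eventually_mem_left h, hG.eventually_right hφ h'.1, hG.eventually_left hψ h'.2]
    with p h h₁ h₂ using .impL h h₁ h₂

theorem imp_right (hG : Generic S Φ A B) (hφ : φ.Over S) (hψ : ψ.Over S) (h : φ.imp ψ ∈ B) :
    φ ∈ A ∧ ψ ∈ B := by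
  constructor <;> by_contra h' <;> refine hG.false_of_eventually ?_
  · filter_upwards [eventually_mem_right h, hG.eventually_left hφ h'] with p h h'
    exact .impR h (h'.mono subset_rfl (Set.subset_insert _ _))
  · filter_upwards [eventually_mem_right h, hG.eventually_right hψ h'] with p h h'
    exact .impR h (h'.mono (Set.subset_insert _ _) subset_rfl)

theorem iff_left (hG : Generic S Φ A B) (hφ : φ.Over S) (hψ : ψ.Over S) (h : φ.iff ψ ∈ A) :
    (φ ∈ B ∧ ψ ∈ B) ∨ (φ ∈ A ∧ ψ ∈ A) := by
  by_contra! h'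
  -- One of the two formulas is missing from `B`; adding that one already gives provability, and the
  -- other is added by weakening.
  have h₁ : ∀ᶠ p : FinitePart A B in Filter.atTop,
      Prv Φ p.1.1 (insert φ (insert ψ p.1.2)) := by
    by_cases h : φ ∈ B
    · exact (hG.eventually_right hψ (h'.1 h)).mono fun _ h =>
        h.mono subset_rfl (Set.subset_insert _ _)
    · exact (hG.eventually_right hφ h).mono fun _ h =>
        h.mono subset_rfl (Set.insert_subset_insert (Set.subset_insert _ _))
  have h₂ : ∀ᶠ p : FinitePart A B in Filter.atTop,
      Prv Φ (insert φ (insert ψ p.1.1)) p.1.2 := by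
    by_cases h : φ ∈ A
    · exact (hG.eventually_left hψ (h'.2 h)).mono fun _ h =>
        h.mono (Set.subset_insert _ _) subset_rfl
    · exact (hG.eventually_left hφ h).mono fun _ h =>
        h.mono (Set.insert_subset_insert (Set.subset_insert _ _)) subset_rfl
  refine hG.false_of_eventually ?_
  filter_upwards [eventually_mem_left h, h₁, h₂] with p h h₁ h₂ using .iffL h h₁ h₂

theorem iff_right (hG : Generic S Φ A B) (hφ : φ.Over S) (hψ : ψ.Over S) (h : φ.iff ψ ∈ B) :
    (φ ∈ A ∧ ψ ∈ B) ∨ (ψ ∈ A ∧ φ ∈ B) := by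
  by_contra! h'
  have key {φ ψ : Form L Obj 0} (hφ : φ.Over S) (hψ : ψ.Over S) (h : φ ∈ A → ψ ∉ B) :
      ∀ᶠ p : FinitePart A B in Filter.atTop, Prv Φ (insert φ p.1.1) (insert ψ p.1.2) := by
    by_cases hA : φ ∈ A
    · exact (hG.eventually_right hψ (h hA)).mono fun _ h =>
        h.mono (Set.subset_insert _ _) subset_rfl
    · exact (hG.eventually_left hφ hA).mono fun _ h =>
        h.mono subset_rfl (Set.subset_insert _ _)
  refine hG.false_of_eventually ?_
  filter_upwards [eventually_mem_right h, key hφ hψ h'.1, key hψ hφ h'.2] with p h h₁ h₂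
    using .iffR h h₁ h₂

theorem all_left (hG : Generic S Φ A B) {φ : Form L Obj 1} (hφ : φ.Over S) {t : Tm L Obj 0}
    (ht : Tm.Over S t) (h : φ.all ∈ A) : φ.subst (Subst.fill fun _ => t) ∈ A := by
  by_contra h'
  refine hG.false_of_eventually ?_
  filter_upwards [eventually_mem_left h,
    hG.eventually_left (hφ.subst (Subst.over_fill fun _ => ht)) h'] with p h h' using .allL h t h'

theorem ex_right (hG : Generic S Φ A B) {φ : Form L Obj 1} (hφ : φ.Over S) {t : Tm L Obj 0}
    (ht : Tm.Over S t) (h : φ.ex ∈ B) : φ.subst (Subst.fill fun _ => t) ∈ B := by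
  by_contra h'
  refine hG.false_of_eventually ?_
  filter_upwards [eventually_mem_right h,
    hG.eventually_right (hφ.subst (Subst.over_fill fun _ => ht)) h'] with p h h' using .exR h t h'

theorem defn_right (hG : Generic S Φ A B) {i : Fin n} {r : Rule L Obj 0} (hr : r ∈ (Φ i).rules)
    (hb : r.body.Over S) {s : Fin (0 + r.k) → Tm L Obj 0} (hs : ∀ j, Tm.Over S (s j))
    (h : .rel r.head (fun j => Term.subst (r.args j) (Subst.fill s)) ∈ B) :
    r.body.subst (Subst.fill s) ∈ B := by
  by_contra h'
  refine hG.false_of_eventually ?_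
  filter_upwards [eventually_mem_right h,
    hG.eventually_right (hb.subst (Subst.over_fill hs)) h'] with p h h' using .defR hr s h h'

theorem eq_swap_left [Infinite Obj] (hG : Generic S Φ A B) {t s : Tm L Obj 0} (ht : Tm.Over S t)
    (hs : Tm.Over S s) (he : .eq t s ∈ A) {ψ : Form L Obj 2} (hψ : ψ.Over S)
    (h : ψ.subst (Subst.fill ![t, s]) ∈ A) : ψ.subst (Subst.fill ![s, t]) ∈ A := by
  by_contra h'
  refine hG.false_of_eventually ?_
  filter_upwards [eventually_mem_left h, eventually_mem_left he, hG.eventually_left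
    (hψ.subst (Subst.over_fill (ts := ![s, t]) (Fin.forall_fin_two.2 ⟨hs, ht⟩))) h']
    with p h he h' using .eq_swap_left p.2.1.2 p.2.2.2 he ψ h h'

theorem eq_swap_right [Infinite Obj] (hG : Generic S Φ A B) {t s : Tm L Obj 0} (ht : Tm.Over S t)
    (hs : Tm.Over S s) (he : .eq t s ∈ A) {ψ : Form L Obj 2} (hψ : ψ.Over S)
    (h : ψ.subst (Subst.fill ![t, s]) ∈ B) : ψ.subst (Subst.fill ![s, t]) ∈ B := by
  by_contra h'
  refine hG.false_of_eventually ?_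
  filter_upwards [eventually_mem_right h, eventually_mem_left he, hG.eventually_right
    (hψ.subst (Subst.over_fill (ts := ![s, t]) (Fin.forall_fin_two.2 ⟨hs, ht⟩))) h']
    with p h he h' using .eq_swap_right p.2.1.2 p.2.2.2 he ψ h h'

end Generic

end FOID
-- Semantics of positive formulas and the term model
namespace FOID

open FirstOrder Language

variable {L : FirstOrder.Language.{u, v}} {Obj : Type w}

/-! ### Semantics of substitution -/

section Semantics

variable {M : Type*} [L.Structure M]

theorem realize_relabel_castAdd {m : ℕ} (t : Tm L Obj m) (v : Obj → M) (xs : Fin m → M) (a : M) :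
    (t.relabel (Sum.map id (Fin.castAdd 1))).realize
      (Sum.elim v (Fin.snoc (α := fun _ => M) xs a)) = t.realize (Sum.elim v xs) := by
  rw [Term.realize_relabel]
  congr 1
  funext x
  rcases x with o | i
  · rfl
  · exact Fin.snoc_castSucc (α := fun _ => M) a xs i

theorem Form.holds_subst {n m : ℕ} (φ : Form L Obj n) (σ : Subst L Obj n m) (v : Obj → M)
    (I J : Interp L M) (xs : Fin m → M) :
    (φ.subst σ).Holds v I J xs ↔
      φ.Holds (fun o => (σ (.inl o)).realize (Sum.elim v xs)) I J
        (fun i => (σ (.inr i)).realize (Sum.elim v xs)) := by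
  have term {n m : ℕ} (t : Tm L Obj n) (σ : Subst L Obj n m) (xs : Fin m → M) :
      (Term.subst t σ).realize (Sum.elim v xs) =
        t.realize (Sum.elim (fun o => (σ (.inl o)).realize (Sum.elim v xs))
          (fun i => (σ (.inr i)).realize (Sum.elim v xs))) := by
    rw [Term.realize_subst]
    congr 1
    funext x
    rcases x with o | i <;> rfl
  have lift {n m : ℕ} (σ : Subst L Obj n m) (xs : Fin m → M) (a : M) :
      (fun i => (σ.lift 1 (.inr i)).realize (Sum.elim v (Fin.snoc (α := fun _ => M) xs a))) =
        Fin.snoc (α := fun _ => M) (fun i => (σ (.inr i)).realize (Sum.elim v xs)) a := by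
    funext i
    refine Fin.lastCases ?_ (fun j => ?_) i
    · rw [Subst.lift_last, Fin.snoc_last]
      exact Fin.snoc_last (α := fun _ => M) a xs
    · rw [Subst.lift_castSucc, Fin.snoc_castSucc, realize_relabel_castAdd]
  induction φ generalizing m I J with
  | top | bot => rfl
  | eq t s => simp only [Form.subst, Form.Holds, term]
  | rel P ts => simp only [Form.subst, Form.Holds, term]
  | neg φ ih => simp only [Form.subst, Form.Holds, ih]
  | and φ ψ ih₁ ih₂ | or φ ψ ih₁ ih₂ | imp φ ψ ih₁ ih₂ | iff φ ψ ih₁ ih₂ =>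
    simp only [Form.subst, Form.Holds, ih₁, ih₂]
  | all φ ih | ex φ ih =>
    simp only [Form.subst, Form.Holds, ih, Subst.lift_inl, realize_relabel_castAdd, lift]

theorem Form.holds_subst_fill {n m : ℕ} (φ : Form L Obj n) (ts : Fin n → Tm L Obj m) (v : Obj → M)
    (I J : Interp L M) (xs : Fin m → M) :
    (φ.subst (Subst.fill ts)).Holds v I J xs ↔
      φ.Holds v I J (fun i => (ts i).realize (Sum.elim v xs)) :=
  φ.holds_subst _ v I J xs

theorem Form.sat_toID (H : ∀ k : ℕ, Set (Set (Fin k → M))) {n : ℕ} (φ : Form L Obj n)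
    (v : Obj → M) (xs : Fin n → M) :
    φ.toID.Sat H v xs ↔ φ.Holds v (interp L M) (interp L M) xs := by
  induction φ with
  | top | bot | eq t s | rel P ts => rfl
  | neg φ ih => simp only [Form.toID, IDForm.Sat, Form.Holds, ih]
  | and φ ψ ih₁ ih₂ | or φ ψ ih₁ ih₂ | imp φ ψ ih₁ ih₂ =>
    simp only [Form.toID, IDForm.Sat, Form.Holds, ih₁, ih₂]
  | iff φ ψ ih₁ ih₂ =>
    simp only [Form.toID, IDForm.Sat, Form.Holds, ih₁, ih₂, iff_iff_implies_and_implies]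
  | all φ ih | ex φ ih => simp only [Form.toID, IDForm.Sat, Form.Holds, ih]

/-! ### Positive formulas -/

/-- Without negation every predicate occurrence is positive, so the interpretation of negative
occurrences is never consulted and may be exchanged freely. -/
theorem Form.IsLitComb.holds_mono {n : ℕ} {φ : Form L Obj n} (hφ : φ.IsLitComb)
    (hneg : φ.NegFree) {v : Obj → M} {I I' : Interp L M} (h : I ≤ I') (J J' : Interp L M)
    {xs : Fin n → M} (hI : φ.Holds v I J xs) : φ.Holds v I' J' xs := by
  induction hφ with
  | atom φ hat =>
    cases φ with
    | rel P ts => exact h P hI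
    | top | bot | eq => exact hI
    | _ => exact hat.elim
  | negAtom => exact hneg.elim
  | and φ ψ _ _ ih₁ ih₂ => exact ⟨ih₁ hneg.1 hI.1, ih₂ hneg.2 hI.2⟩
  | or φ ψ _ _ ih₁ ih₂ => exact hI.imp (ih₁ hneg.1) (ih₂ hneg.2)

theorem Defn.step_mono {Φ : Defn L Obj 0} (hΦ : ∀ r ∈ Φ.rules, r.body.IsLitComb)
    (hneg : ∀ r ∈ Φ.rules, r.body.NegFree) (v : Obj → M) (xs : Fin 0 → M) {I I' : Interp L M}
    (h : I ≤ I') (J J' : Interp L M) : Φ.step v xs I J ≤ Φ.step v xs I' J' := by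
  rintro P a ⟨r, hr, b, ha, hb⟩
  exact ⟨r, hr, b, ha, (hΦ r hr).holds_mono (hneg r hr) h J J' hb⟩

/-- Converts truth of the body of a minor premise into truth of the rule body in a competing
interpretation. Positivity makes one implication between each hypothesis and its predicate
sufficient. -/
theorem Form.IsLitComb.holds_of_replace {n : ℕ} {φ : Form L Obj n} (hφ : φ.IsLitComb)
    (hneg : φ.NegFree) {D : Set (Pred L)} {F : ∀ P : Pred L, Form L Obj P.1} {v : Obj → M}
    {I I' : Interp L M} (hD : ∀ P ∈ D, ∀ a, (F P).Holds v I I a → a ∈ I' P)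
    (hI : ∀ P ∉ D, I P ≤ I' P) (J : Interp L M) {xs : Fin n → M}
    (h : (φ.replace D F true).Holds v I I xs) : φ.Holds v I' J xs := by
  induction hφ with
  | atom φ hat =>
    cases φ with
    | rel P ts =>
      rw [Form.replace] at h
      split_ifs at h with hP
      · exact hD P hP.2 _ ((Form.holds_subst_fill _ _ _ _ _ _).1 h)
      · exact hI P (fun h => hP ⟨rfl, h⟩) h
    | top | bot | eq => exact h
    | _ => exact hat.elim
  | negAtom => exact hneg.elim
  | and φ ψ _ _ ih₁ ih₂ => exact ⟨ih₁ hneg.1 h.1, ih₂ hneg.2 h.2⟩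
  | or φ ψ _ _ ih₁ ih₂ => exact h.imp (ih₁ hneg.1) (ih₂ hneg.2)

end Semantics

theorem Form.Over.replace {S : Set (Sym L Obj)} {n : ℕ} {φ : Form L Obj n} (hφ : φ.Over S)
    (D : Set (Pred L)) {F : ∀ P : Pred L, Form L Obj P.1} (hF : ∀ P, (F P).Over S) (b : Bool) :
    (φ.replace D F b).Over S := by
  induction φ generalizing b with
  | top | bot => trivial
  | eq t s => exact hφ
  | rel P ts =>
    rw [Form.replace]
    split_ifs
    · exact (hF P).subst (Subst.over_fill hφ.2)
    · exact hφ
  | neg φ ih => exact ih hφ _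
  | all φ ih | ex φ ih => exact ih hφ _
  | and φ ψ ih₁ ih₂ | or φ ψ ih₁ ih₂ | imp φ ψ ih₁ ih₂ => exact ⟨ih₁ hφ.1 _, ih₂ hφ.2 _⟩
  | iff φ ψ ih₁ ih₂ =>
    exact ⟨⟨ih₁ hφ.1 _, ih₂ hφ.2 _⟩, ih₂ hφ.2 _, ih₁ hφ.1 _⟩

/-! ### Elimination of the symbols outside a set -/

open Classical in
/-- Replaces subterms that begin with a symbol outside `S` by the object symbol `d`. -/
noncomputable def Tm.norm (S : Set (Sym L Obj)) (d : Obj) {n : ℕ} : Tm L Obj n → Tm L Obj n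
  | .var (.inl o) => if .inr (.inr o) ∈ S then .var (.inl o) else Tm.obj d
  | .var (.inr i) => .var (.inr i)
  | .func (l := k) f ts =>
      if .inl ⟨k, f⟩ ∈ S then .func f fun i => Tm.norm S d (ts i) else Tm.obj d

open Classical in
/-- Replaces subterms that begin with a symbol outside `S` by the object symbol `d`, and atoms
that begin with a predicate symbol outside `S` by `⊥`. -/
noncomputable def Form.norm (S : Set (Sym L Obj)) (d : Obj) : {n : ℕ} → Form L Obj n → Form L Obj n
  | _, .top => .top
  | _, .bot => .bot
  | _, .eq t s => .eq (Tm.norm S d t) (Tm.norm S d s)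
  | _, .rel P ts => if .inr (.inl P) ∈ S then .rel P fun i => Tm.norm S d (ts i) else .bot
  | _, .neg φ => .neg (φ.norm S d)
  | _, .and φ ψ => .and (φ.norm S d) (ψ.norm S d)
  | _, .or φ ψ => .or (φ.norm S d) (ψ.norm S d)
  | _, .imp φ ψ => .imp (φ.norm S d) (ψ.norm S d)
  | _, .iff φ ψ => .iff (φ.norm S d) (ψ.norm S d)
  | _, .all φ => .all (φ.norm S d)
  | _, .ex φ => .ex (φ.norm S d)

section Norm

variable {S : Set (Sym L Obj)} {d : Obj}

theorem Tm.over_norm (hd : .inr (.inr d) ∈ S) {n : ℕ} (t : Tm L Obj n) :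
    Tm.Over S (Tm.norm S d t) := by
  induction t with
  | var x =>
    rcases x with o | i
    · rw [Tm.norm]
      split_ifs with h
      · exact h
      · exact hd
    · trivial
  | func f ts ih =>
    rw [Tm.norm]
    split_ifs with h
    · exact ⟨h, ih⟩
    · exact hd

theorem Tm.Over.norm_eq {n : ℕ} {t : Tm L Obj n} (h : Tm.Over S t) (d : Obj) :
    Tm.norm S d t = t := by
  induction t with
  | var x =>
    rcases x with o | i
    · exact if_pos h
    · rfl
  | func f ts ih =>
    rw [Tm.norm, if_pos h.1]
    congr 1
    funext i
    exact ih i (h.2 i)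

theorem Form.over_norm (hd : .inr (.inr d) ∈ S) {n : ℕ} (φ : Form L Obj n) :
    (φ.norm S d).Over S := by
  induction φ with
  | top | bot => trivial
  | eq t s => exact ⟨Tm.over_norm hd t, Tm.over_norm hd s⟩
  | rel P ts =>
    rw [Form.norm]
    split_ifs with h
    · exact ⟨h, fun i => Tm.over_norm hd (ts i)⟩
    · trivial
  | neg φ ih | all φ ih | ex φ ih => exact ih
  | and φ ψ ih₁ ih₂ | or φ ψ ih₁ ih₂ | imp φ ψ ih₁ ih₂ | iff φ ψ ih₁ ih₂ => exact ⟨ih₁, ih₂⟩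

end Norm

/-! ### The term model -/

/-- Two closed terms are identified if their normal forms cannot be told apart by the
membership of formulas over `S` in `A` and `B`. -/
def tmSetoid (S : Set (Sym L Obj)) (d : Obj) (A B : Set (Form L Obj 0)) : Setoid (Tm L Obj 0) where
  r t s := ∀ ψ : Form L Obj 1, ψ.Over S →
    (ψ.subst (Subst.fill fun _ => Tm.norm S d t) ∈ A ↔
      ψ.subst (Subst.fill fun _ => Tm.norm S d s) ∈ A) ∧
    (ψ.subst (Subst.fill fun _ => Tm.norm S d t) ∈ B ↔
      ψ.subst (Subst.fill fun _ => Tm.norm S d s) ∈ B)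
  iseqv :=
    { refl := fun _ _ _ => ⟨Iff.rfl, Iff.rfl⟩
      symm := fun h ψ hψ => ⟨(h ψ hψ).1.symm, (h ψ hψ).2.symm⟩
      trans := fun h h' ψ hψ => ⟨(h ψ hψ).1.trans (h' ψ hψ).1, (h ψ hψ).2.trans (h' ψ hψ).2⟩ }

/-- The domain of the term model. -/
def TmModel (S : Set (Sym L Obj)) (d : Obj) (A B : Set (Form L Obj 0)) : Type (max u w) :=
  Quotient (tmSetoid S d A B)

namespace TmModel

variable {S : Set (Sym L Obj)} {d : Obj} {A B : Set (Form L Obj 0)}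

/-- The element of the term model given by a closed term. -/
def cls (t : Tm L Obj 0) : TmModel S d A B := Quotient.mk (tmSetoid S d A B) t

theorem cls_surjective : Function.Surjective (cls : Tm L Obj 0 → TmModel S d A B) :=
  Quotient.mk_surjective

theorem cls_eq_of_norm_eq {t s : Tm L Obj 0} (h : Tm.norm S d t = Tm.norm S d s) :
    (cls t : TmModel S d A B) = cls s :=
  Quotient.sound fun ψ _ => by rw [h]; exact ⟨Iff.rfl, Iff.rfl⟩

/-- All closed terms of the language enter the domain, because every function symbol needs a value,
but passing to normal forms adds no elements beyond those named over `S`. The saturation properties,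
which concern `S` only, thus reach every element. -/
theorem exists_over (hd : .inr (.inr d) ∈ S) (a : TmModel S d A B) :
    ∃ t, Tm.Over S t ∧ cls t = a := by
  obtain ⟨t, rfl⟩ := cls_surjective a
  exact ⟨Tm.norm S d t, Tm.over_norm hd t,
    cls_eq_of_norm_eq ((Tm.over_norm hd t).norm_eq d)⟩

/-- The equivalence speaks of formulas with one open place. A tuple is exchanged one coordinate at a
time, with the other coordinates frozen as closed terms. -/
theorem mem_iff_of_cls_eq (hd : .inr (.inr d) ∈ S) {k : ℕ} {ts ss : Fin k → Tm L Obj 0}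
    (h : ∀ i, (cls (ts i) : TmModel S d A B) = cls (ss i)) {ψ : Form L Obj k} (hψ : ψ.Over S) :
    (ψ.subst (Subst.fill fun i => Tm.norm S d (ts i)) ∈ A ↔
      ψ.subst (Subst.fill fun i => Tm.norm S d (ss i)) ∈ A) ∧
    (ψ.subst (Subst.fill fun i => Tm.norm S d (ts i)) ∈ B ↔
      ψ.subst (Subst.fill fun i => Tm.norm S d (ss i)) ∈ B) := by
  let mix (j : ℕ) : Form L Obj 0 := ψ.subst (Subst.fill fun i =>
    if i.1 < j then Tm.norm S d (ss i) else Tm.norm S d (ts i))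
  have key : ∀ j ≤ k, (mix 0 ∈ A ↔ mix j ∈ A) ∧ (mix 0 ∈ B ↔ mix j ∈ B) := by
    intro j hj
    induction j with
    | zero => exact ⟨Iff.rfl, Iff.rfl⟩
    | succ j ih =>
      -- Only coordinate `j` stays open: coordinates below it have already been exchanged, those
      -- above it not yet.
      let χ : Form L Obj 1 := ψ.subst (Subst.fill fun i =>
        if i.1 = j then .var (.inr 0) else
          (if i.1 < j then Tm.norm S d (ss i) else Tm.norm S d (ts i)).relabel
            (Sum.map id (Fin.castAdd 1)))
      have hχ : χ.Over S := hψ.subst <| Subst.over_fill fun i => by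
        split_ifs
        · trivial
        · exact (Tm.over_norm hd _).relabel _
        · exact (Tm.over_norm hd _).relabel _
      have hχs (t : Tm L Obj 0) : χ.subst (Subst.fill fun _ => t) = ψ.subst (Subst.fill fun i =>
          if i.1 = j then t else
            if i.1 < j then Tm.norm S d (ss i) else Tm.norm S d (ts i)) := by
        rw [Form.subst_subst]
        congr 1
        funext x
        rcases x with o | i
        · rfl
        · change Term.subst (ite _ _ _) _ = ite _ _ _
          split_ifs
          · rfl
          · exact relabel_subst_fill _ _ _
          · exact relabel_subst_fill _ _ _
      have h₁ : χ.subst (Subst.fill fun _ => Tm.norm S d (ts ⟨j, hj⟩)) = mix j := by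
        rw [hχs]
        congr 2
        funext i
        split_ifs with h₁ h₂
        · omega
        · obtain rfl : i = ⟨j, hj⟩ := Fin.ext h₁
          rfl
        · rfl
        · rfl
      have h₂ : χ.subst (Subst.fill fun _ => Tm.norm S d (ss ⟨j, hj⟩)) = mix (j + 1) := by
        rw [hχs]
        congr 2
        funext i
        split_ifs with h₁ h₂
        · obtain rfl : i = ⟨j, hj⟩ := Fin.ext h₁
          rfl
        all_goals first | rfl | omega
      have := Quotient.exact (h ⟨j, hj⟩) χ hχ
      rw [h₁, h₂] at this
      have ih := ih (Nat.le_of_succ_le hj)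
      exact ⟨ih.1.trans this.1, ih.2.trans this.2⟩
  have := key k le_rfl
  simpa only [mix, Nat.not_lt_zero, if_false, Fin.is_lt, if_true] using this

/-- A test formula for the values of `f` becomes a test formula for its arguments by composition
with `f`. If `f` is outside `S`, both terms have the normal form `d`. -/
theorem cls_func (hd : .inr (.inr d) ∈ S) {k : ℕ} (f : L.Functions k) {ts ss : Fin k → Tm L Obj 0}
    (h : ∀ i, (cls (ts i) : TmModel S d A B) = cls (ss i)) :
    (cls (.func f ts) : TmModel S d A B) = cls (.func f ss) := by
  by_cases hf : .inl ⟨k, f⟩ ∈ S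
  · refine Quotient.sound fun ψ hψ => ?_
    have := mem_iff_of_cls_eq hd h
      (ψ := ψ.subst (Subst.fill fun _ => .func f fun i => .var (.inr i)))
      (hψ.subst (Subst.over_fill fun _ => ⟨hf, fun _ => trivial⟩))
    have comp (us : Fin k → Tm L Obj 0) :
        (Subst.fill fun _ : Fin 1 => (.func f fun i => .var (.inr i) : Tm L Obj k)).comp
          (Subst.fill us) = Subst.fill fun _ => .func f us := by
      funext x
      rcases x with o | i <;> rfl
    simp only [Form.subst_subst, comp] at this
    simp only [Tm.norm, if_pos hf]
    exact this
  · refine cls_eq_of_norm_eq ?_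
    simp only [Tm.norm, if_neg hf]

/-- A closed term that denotes a given element of the term model. -/
noncomputable def rep (a : TmModel S d A B) : Tm L Obj 0 := Quotient.out a

theorem cls_rep (a : TmModel S d A B) : cls (rep a) = a := Quotient.out_eq a

/-- The term model, with given values of the predicate symbols. -/
@[reducible] noncomputable def str (R : Interp L (TmModel S d A B)) :
    L.Structure (TmModel S d A B) where
  funMap f xs := cls (.func f fun i => rep (xs i))
  RelMap {k} P xs := xs ∈ R ⟨k, P⟩

/-- The values of the object symbols in the term model. -/
def val (o : Obj) : TmModel S d A B := cls (Tm.obj o)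

theorem realize_cls (hd : .inr (.inr d) ∈ S) (R : Interp L (TmModel S d A B)) {n : ℕ}
    (t : Tm L Obj n) (ts : Fin n → Tm L Obj 0) :
    let := str R
    t.realize (Sum.elim val fun i => (cls (ts i) : TmModel S d A B)) =
      cls (Term.subst t (Subst.fill ts)) := by
  let := str R
  induction t with
  | var x => rcases x with o | i <;> rfl
  | func f us ih =>
    refine cls_func hd f fun i => ?_
    rw [cls_rep]
    exact ih i

/-- Changing `R` changes only the relations of the structure, not its functions. Together with
`holds_str`, this allows structures with different `R` to be interchanged wherever the predicate
values are passed explicitly. -/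
theorem realize_str (R R' : Interp L (TmModel S d A B)) {n : ℕ} (t : Tm L Obj n)
    (xs : Obj ⊕ Fin n → TmModel S d A B) :
    @Term.realize L _ (str R) _ xs t = @Term.realize L _ (str R') _ xs t := by
  induction t with
  | var x => rfl
  | func f ts ih => exact congrArg (fun g => cls (.func f fun i => rep (g i))) (funext ih)

theorem holds_str (R R' : Interp L (TmModel S d A B)) {n : ℕ} (φ : Form L Obj n)
    (v : Obj → TmModel S d A B) (I J : Interp L (TmModel S d A B)) (xs : Fin n → TmModel S d A B) :
    @Form.Holds L Obj _ (str R) v n I J φ xs ↔ @Form.Holds L Obj _ (str R') v n I J φ xs := by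
  induction φ generalizing I J with
  | top | bot => rfl
  | eq t s => simp only [Form.Holds, realize_str R R']
  | rel P ts => simp only [Form.Holds, realize_str R R']
  | neg φ ih => simp only [Form.Holds, ih]
  | and φ ψ ih₁ ih₂ | or φ ψ ih₁ ih₂ | imp φ ψ ih₁ ih₂ | iff φ ψ ih₁ ih₂ =>
    simp only [Form.Holds, ih₁, ih₂]
  | all φ ih | ex φ ih => simp only [Form.Holds, ih]

end TmModel

end FOID
-- The least interpretation closed under the rules, and the truth lemma
namespace FOID

open FirstOrder Language

variable {L : FirstOrder.Language.{u, v}} {Obj : Type w}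

/-- All symbols of the rule are in `S`. -/
def Rule.Over (S : Set (Sym L Obj)) (r : Rule L Obj 0) : Prop :=
  .inr (.inl r.head) ∈ S ∧ (∀ j, Tm.Over S (r.args j)) ∧ r.body.Over S

theorem Rule.exists_over (r : Rule L Obj 0) : ∃ S : Set (Sym L Obj), S.Finite ∧ r.Over S := by
  choose T hT h using fun j => Tm.exists_over (r.args j)
  obtain ⟨U, hU, h'⟩ := r.body.exists_over
  refine ⟨insert (.inr (.inl r.head)) ((⋃ j, T j) ∪ U),
    ((Set.finite_iUnion hT).union hU).insert _, Set.mem_insert _ _, fun j => (h j).mono ?_,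
    h'.mono ?_⟩
  · exact ((Set.subset_iUnion T j).trans Set.subset_union_left).trans (Set.subset_insert _ _)
  · exact Set.subset_union_right.trans (Set.subset_insert _ _)

theorem Rule.Over.mono {S S' : Set (Sym L Obj)} (hS : S ⊆ S') {r : Rule L Obj 0} (h : r.Over S) :
    r.Over S' :=
  ⟨hS h.1, fun j => (h.2.1 j).mono hS, h.2.2.mono hS⟩

theorem append_elim0_natAdd {M : Type*} {k : ℕ} (c : Fin (0 + k) → M) :
    Fin.append Fin.elim0 (fun j => c (Fin.natAdd 0 j)) = c := by
  funext j
  refine Fin.addCases (fun j => j.elim0) (fun j => ?_) j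
  rw [Fin.append_right]

theorem Subst.lift_fill_comp {n : ℕ} (ts : Fin n → Tm L Obj 0) (t : Tm L Obj 0) :
    ((Subst.fill ts).lift 1).comp (Subst.fill fun _ => t) =
      Subst.fill (Fin.snoc (α := fun _ => Tm L Obj 0) ts t) := by
  funext x
  rcases x with o | i
  · rfl
  · refine Fin.lastCases ?_ (fun j => ?_) i
    · rw [Subst.comp, Subst.lift_last]
      exact (Fin.snoc_last (α := fun _ => Tm L Obj 0) t ts).symm
    · rw [Subst.comp, Subst.lift_castSucc]
      exact (relabel_subst_fill _ _ _).trans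
        (Fin.snoc_castSucc (α := fun _ => Tm L Obj 0) t ts j).symm

namespace TmModel

variable {n : ℕ} {S : Set (Sym L Obj)} {d : Obj} {A B : Set (Form L Obj 0)}

/-- The interpretation `R` makes the atoms in `A` true and is closed under the rules of `Φ`. -/
structure Closed (Φ : Fin n → Defn L Obj 0) (R : Interp L (TmModel S d A B)) : Prop where
  base : ∀ (P : Pred L) (ts : Fin P.1 → Tm L Obj 0), (Form.rel P ts).Over S → .rel P ts ∈ A →
    (fun i => cls (ts i)) ∈ R P
  step_le : ∀ i, @Defn.step L Obj _ (str R) 0 (Φ i) val Fin.elim0 R R ≤ R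

/-- The least interpretation of the predicate symbols that makes the atoms in `A` true and is
closed under the rules of `Φ`. -/
def preds (Φ : Fin n → Defn L Obj 0) : Interp L (TmModel S d A B) :=
  fun P => {a | ∀ R, Closed Φ R → a ∈ R P}

theorem step_str (R R' : Interp L (TmModel S d A B)) (Φ : Defn L Obj 0)
    (I J : Interp L (TmModel S d A B)) :
    @Defn.step L Obj _ (str R) 0 Φ val Fin.elim0 I J =
      @Defn.step L Obj _ (str R') 0 Φ val Fin.elim0 I J := by
  funext P
  simp only [Defn.step, realize_str R R', holds_str R R']

theorem preds_le {Φ : Fin n → Defn L Obj 0} {R : Interp L (TmModel S d A B)} (hR : Closed Φ R) :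
    preds Φ ≤ R :=
  fun _ _ ha => ha R hR

/-- This is the Knaster–Tarski argument: the operators are monotone in their positive argument and
ignore the negative one, so an intersection of closed interpretations is closed. -/
theorem preds_closed {Φ : Fin n → Defn L Obj 0} (hlit : ∀ i, ∀ r ∈ (Φ i).rules, r.body.IsLitComb)
    (hneg : ∀ i, ∀ r ∈ (Φ i).rules, r.body.NegFree) :
    Closed Φ (preds Φ : Interp L (TmModel S d A B)) where
  base P ts hP hm R hR := hR.base P ts hP hm
  step_le i P a ha R hR := by
    refine hR.step_le i P ?_
    rw [step_str _ R] at ha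
    exact @Defn.step_mono L Obj _ (str R) _ (hlit i) (hneg i) _ _ _ _ (preds_le hR) _ _ P a ha

theorem rel_mem_iff (hd : .inr (.inr d) ∈ S) {P : Pred L} (hP : .inr (.inl P) ∈ S)
    {ts ss : Fin P.1 → Tm L Obj 0} (hts : ∀ i, Tm.Over S (ts i)) (hss : ∀ i, Tm.Over S (ss i))
    (h : ∀ i, (cls (ts i) : TmModel S d A B) = cls (ss i)) :
    (Form.rel P ts ∈ A ↔ Form.rel P ss ∈ A) ∧ (Form.rel P ts ∈ B ↔ Form.rel P ss ∈ B) := by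
  have := mem_iff_of_cls_eq hd h (ψ := .rel P fun i => .var (.inr i)) ⟨hP, fun _ => trivial⟩
  simp only [(hts _).norm_eq, (hss _).norm_eq] at this
  exact this

theorem exists_over_tuple (hd : .inr (.inr d) ∈ S) {k : ℕ} (a : Fin k → TmModel S d A B) :
    ∃ ts : Fin k → Tm L Obj 0, (∀ i, Tm.Over S (ts i)) ∧ (fun i => cls (ts i)) = a := by
  choose ts hts h using fun i => exists_over hd (a i)
  exact ⟨ts, hts, funext h⟩

end TmModel

open TmModel

namespace Generic

variable [DecidableEq Obj] {n : ℕ} {S : Set (Sym L Obj)} {d : Obj}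
  {Φ : Fin n → Defn L Obj 0} {A B : Set (Form L Obj 0)}

/-- The swap is applied with `ψ` put into the first or into the second of the two places. The two
choices give the two directions of indiscernibility. -/
theorem cls_eq_of_eq_mem [Infinite Obj] (hG : Generic S Φ A B) {t s : Tm L Obj 0} (ht : Tm.Over S t)
    (hs : Tm.Over S s) (h : .eq t s ∈ A) : (cls t : TmModel S d A B) = cls s := by
  refine Quotient.sound fun ψ hψ => ?_
  rw [ht.norm_eq, hs.norm_eq]
  have hχ (j : Fin 2) : (ψ.subst (Subst.fill fun _ => (.var (.inr j) : Tm L Obj 2))).Over S :=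
    hψ.subst (Subst.over_fill fun _ => trivial)
  have comp (j : Fin 2) (a b : Tm L Obj 0) :
      (ψ.subst (Subst.fill fun _ => (.var (.inr j) : Tm L Obj 2))).subst (Subst.fill ![a, b]) =
        ψ.subst (Subst.fill fun _ => ![a, b] j) := by
    rw [Form.subst_subst]
    congr 1
    funext x
    rcases x with o | i <;> rfl
  have hA (j : Fin 2) := hG.eq_swap_left ht hs h (hχ j)
  have hB (j : Fin 2) := hG.eq_swap_right ht hs h (hχ j)
  simp only [comp] at hA hB
  exact ⟨⟨hA 0, hA 1⟩, hB 0, hB 1⟩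

/-- The formula `x = s` separates the two terms: indiscernibility would carry `t = s` in `B` to `s =
s` in `B`, against reflexivity. -/
theorem cls_ne_of_eq_mem (hG : Generic S Φ A B) {t s : Tm L Obj 0} (ht : Tm.Over S t)
    (hs : Tm.Over S s) (h : .eq t s ∈ B) : (cls t : TmModel S d A B) ≠ cls s := by
  intro he
  have comp (a : Tm L Obj 0) : (Form.eq (.var (.inr 0))
      (s.relabel (Sum.map id (Fin.castAdd 1))) : Form L Obj 1).subst (Subst.fill fun _ => a) =
        .eq a s := by
    simp only [Form.subst, relabel_subst_fill]
    rfl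
  have := (Quotient.exact he (.eq (.var (.inr 0)) (s.relabel (Sum.map id (Fin.castAdd 1))))
    ⟨trivial, hs.relabel _⟩).2
  rw [comp, comp, ht.norm_eq, hs.norm_eq] at this
  exact hG.eq_notMem s (this.1 h)

/-- A positive formula is not in `B` if it is true for an interpretation that makes all atoms
in `B` false. -/
theorem notMem_of_holds (hG : Generic S Φ A B) (hd : .inr (.inr d) ∈ S)
    (R : Interp L (TmModel S d A B)) {K J : Interp L (TmModel S d A B)}
    (hK : ∀ P us, (∀ i, Tm.Over S (us i)) → (fun i => cls (us i)) ∈ K P → .rel P us ∉ B)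
    {k : ℕ} {φ : Form L Obj k} (hlit : φ.IsLitComb) (hneg : φ.NegFree) (hφ : φ.Over S)
    {ts : Fin k → Tm L Obj 0} (hts : ∀ i, Tm.Over S (ts i))
    (h : @Form.Holds L Obj _ (str R) val k K J φ fun i => cls (ts i)) :
    φ.subst (Subst.fill ts) ∉ B := by
  let := str R
  induction hlit with
  | atom φ hat =>
    cases φ with
    | top => exact hG.top_notMem
    | bot => exact h.elim
    | eq t s =>
      intro hm
      refine hG.cls_ne_of_eq_mem (d := d) (hφ.1.subst (Subst.over_fill hts))
        (hφ.2.subst (Subst.over_fill hts)) hm ?_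
      rw [← realize_cls hd R, ← realize_cls hd R]
      exact h
    | rel P us =>
      refine hK P _ (fun i => (hφ.2 i).subst (Subst.over_fill hts)) ?_
      simp only [← realize_cls hd R]
      exact h
    | _ => exact hat.elim
  | negAtom => exact hneg.elim
  | and φ ψ _ _ ih₁ ih₂ =>
    intro hm
    rcases hG.and_right (hφ.1.subst (Subst.over_fill hts)) (hφ.2.subst (Subst.over_fill hts)) hm
      with hm | hm
    · exact ih₁ hneg.1 hφ.1 h.1 hm
    · exact ih₂ hneg.2 hφ.2 h.2 hm
  | or φ ψ _ _ ih₁ ih₂ =>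
    intro hm
    have hm := hG.or_right (hφ.1.subst (Subst.over_fill hts)) (hφ.2.subst (Subst.over_fill hts)) hm
    rcases h with h | h
    · exact ih₁ hneg.1 hφ.1 h hm.1
    · exact ih₂ hneg.2 hφ.2 h hm.2

/-- The largest interpretation that makes the atoms in `B` false. -/
def avoid (S : Set (Sym L Obj)) (d : Obj) (A B : Set (Form L Obj 0)) :
    Interp L (TmModel S d A B) :=
  fun P => {a | .inr (.inl P) ∈ S ∧ ∀ us, (∀ i, Tm.Over S (us i)) →
    (fun i => cls (us i)) = a → .rel P us ∉ B}

/-- This is where (def R) enters. If the head of a rule instance is in `B`, so is its body; but a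
body that is true in `avoid` is not in `B`. Predicates outside `S` get the empty value, which causes
no conflict because all rules are over `S`. -/
theorem avoid_closed (hG : Generic S Φ A B) (hd : .inr (.inr d) ∈ S)
    (hlit : ∀ i, ∀ r ∈ (Φ i).rules, r.body.IsLitComb)
    (hneg : ∀ i, ∀ r ∈ (Φ i).rules, r.body.NegFree) (hover : ∀ i, ∀ r ∈ (Φ i).rules, r.Over S) :
    Closed Φ (avoid S d A B) where
  base P ts hP hm := ⟨hP.1, fun us hus h hm' => hG.notMem_right
    ((rel_mem_iff hd hP.1 hus hP.2 (congrFun h)).1.2 hm) hm'⟩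
  step_le i P a ha := by
    obtain ⟨r, hr, b, ha, hb⟩ := ha
    obtain ⟨rfl, ha⟩ := Sigma.mk.inj_iff.1 ha
    obtain rfl := eq_of_heq ha
    obtain ⟨s, hs, hsb⟩ := exists_over_tuple hd (Fin.append Fin.elim0 b)
    obtain ⟨hP, hargs, hbody⟩ := hover i r hr
    refine ⟨hP, fun us hus h hm => ?_⟩
    rw [← hsb] at hb h
    simp only [realize_cls hd] at h
    refine hG.notMem_of_holds hd _ (fun P us hus h => h.2 us hus rfl) (hlit i r hr) (hneg i r hr)
      hbody hs hb (hG.defn_right hr hbody hs ?_)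
    exact (rel_mem_iff hd hP hus (fun j => (hargs j).subst (Subst.over_fill hs))
      (congrFun h)).2.1 hm

/-- Formulas over `S` are true in the term model if they are in `A`, and false if they are
in `B`. -/
theorem truth [Infinite Obj] (hG : Generic S Φ A B) (hd : .inr (.inr d) ∈ S)
    (hlit : ∀ i, ∀ r ∈ (Φ i).rules, r.body.IsLitComb)
    (hneg : ∀ i, ∀ r ∈ (Φ i).rules, r.body.NegFree) (hover : ∀ i, ∀ r ∈ (Φ i).rules, r.Over S)
    {k : ℕ} {φ : Form L Obj k} (hφ : φ.Over S) {ts : Fin k → Tm L Obj 0}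
    (hts : ∀ i, Tm.Over S (ts i)) :
    let I : Interp L (TmModel S d A B) := preds Φ
    let _ := str I
    (φ.subst (Subst.fill ts) ∈ A → φ.Holds val I I fun i => cls (ts i)) ∧
      (φ.subst (Subst.fill ts) ∈ B → ¬ φ.Holds val I I fun i => cls (ts i)) := by
  intro I _
  have snoc {k : ℕ} (ts : Fin k → Tm L Obj 0) (t : Tm L Obj 0) :
      (fun i => cls (Fin.snoc (α := fun _ => Tm L Obj 0) ts t i) : Fin (k + 1) → TmModel S d A B) =
        Fin.snoc (α := fun _ => TmModel S d A B) (fun i => cls (ts i)) (cls t) := by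
    funext i
    refine Fin.lastCases ?_ (fun j => ?_) i <;> simp
  have snoc_over {k : ℕ} {ts : Fin k → Tm L Obj 0} (hts : ∀ i, Tm.Over S (ts i)) {t : Tm L Obj 0}
      (ht : Tm.Over S t) (i : Fin (k + 1)) :
      Tm.Over S (Fin.snoc (α := fun _ => Tm L Obj 0) ts t i) := by
    refine Fin.lastCases ?_ (fun j => ?_) i <;> simp [hts, ht]
  have inst {k : ℕ} (φ : Form L Obj (k + 1)) (ts : Fin k → Tm L Obj 0) (t : Tm L Obj 0) :
      (φ.subst ((Subst.fill ts).lift 1)).subst (Subst.fill fun _ => t) =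
        φ.subst (Subst.fill (Fin.snoc (α := fun _ => Tm L Obj 0) ts t)) := by
    rw [← Subst.lift_fill_comp]
    exact Form.subst_subst _ _ _
  induction φ with
  | top => exact ⟨fun _ => trivial, fun h => (hG.top_notMem h).elim⟩
  | bot => exact ⟨fun h => (hG.bot_notMem h).elim, fun _ => id⟩
  | eq t s =>
    have ht := hφ.1.subst (Subst.over_fill hts)
    have hs := hφ.2.subst (Subst.over_fill hts)
    simp only [Form.Holds, realize_cls hd]
    exact ⟨hG.cls_eq_of_eq_mem ht hs, hG.cls_ne_of_eq_mem ht hs⟩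
  | rel P us =>
    have hus := fun i => (hφ.2 i).subst (Subst.over_fill hts)
    simp only [Form.Holds, realize_cls hd]
    -- Atoms in `A` hold by the construction of `preds`; those in `B` fail because `preds` lies
    -- below `avoid`.
    exact ⟨(preds_closed hlit hneg).base P _ (show (Form.rel P _).Over S from ⟨hφ.1, hus⟩),
      fun hm h => (preds_le (hG.avoid_closed hd hlit hneg hover) P h).2 _ hus rfl hm⟩
  | neg φ ih =>
    have hφ' : (φ.subst (Subst.fill ts)).Over S := hφ.subst (Subst.over_fill hts)
    have ih := ih hφ hts
    exact ⟨fun h => ih.2 (hG.neg_left hφ' h), fun h h' => h' (ih.1 (hG.neg_right hφ' h))⟩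
  | and φ ψ ih₁ ih₂ =>
    have hφ' := hφ.1.subst (Subst.over_fill hts)
    have hψ' := hφ.2.subst (Subst.over_fill hts)
    have ih₁ := ih₁ hφ.1 hts
    have ih₂ := ih₂ hφ.2 hts
    exact ⟨fun h => (hG.and_left hφ' hψ' h).imp ih₁.1 ih₂.1,
      fun h h' => (hG.and_right hφ' hψ' h).elim (ih₁.2 · h'.1) (ih₂.2 · h'.2)⟩
  | or φ ψ ih₁ ih₂ =>
    have hφ' := hφ.1.subst (Subst.over_fill hts)
    have hψ' := hφ.2.subst (Subst.over_fill hts)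
    have ih₁ := ih₁ hφ.1 hts
    have ih₂ := ih₂ hφ.2 hts
    exact ⟨fun h => (hG.or_left hφ' hψ' h).imp ih₁.1 ih₂.1,
      fun h h' => h'.elim (ih₁.2 (hG.or_right hφ' hψ' h).1) (ih₂.2 (hG.or_right hφ' hψ' h).2)⟩
  | imp φ ψ ih₁ ih₂ =>
    have hφ' := hφ.1.subst (Subst.over_fill hts)
    have hψ' := hφ.2.subst (Subst.over_fill hts)
    have ih₁ := ih₁ hφ.1 hts
    have ih₂ := ih₂ hφ.2 hts
    exact ⟨fun h h' => (hG.imp_left hφ' hψ' h).elim (fun h => (ih₁.2 h h').elim) ih₂.1,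
      fun h h' => ih₂.2 (hG.imp_right hφ' hψ' h).2 (h' (ih₁.1 (hG.imp_right hφ' hψ' h).1))⟩
  | iff φ ψ ih₁ ih₂ =>
    have hφ' := hφ.1.subst (Subst.over_fill hts)
    have hψ' := hφ.2.subst (Subst.over_fill hts)
    have ih₁ := ih₁ hφ.1 hts
    have ih₂ := ih₂ hφ.2 hts
    refine ⟨fun h => ?_, fun h h' => ?_⟩
    · rcases hG.iff_left hφ' hψ' h with h | h
      · exact ⟨fun h' => (ih₁.2 h.1 h').elim, fun h' => (ih₂.2 h.2 h').elim⟩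
      · exact ⟨fun _ => ih₂.1 h.2, fun _ => ih₁.1 h.1⟩
    · rcases hG.iff_right hφ' hψ' h with h | h
      · exact ih₂.2 h.2 (h'.1 (ih₁.1 h.1))
      · exact ih₁.2 h.2 (h'.2 (ih₂.1 h.1))
  | all φ ih =>
    have hφ' : (φ.subst ((Subst.fill ts).lift 1)).Over S :=
      (show φ.Over S from hφ).subst (Subst.Over.lift (Subst.over_fill hts) 1)
    refine ⟨fun h a => ?_, fun h h' => ?_⟩
    · obtain ⟨t, ht, rfl⟩ := exists_over hd a
      have := hG.all_left hφ' ht h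
      rw [inst] at this
      rw [← snoc]
      exact (ih hφ (snoc_over hts ht)).1 this
    · obtain ⟨x, hx, hm⟩ := hG.all_right _ hφ' h
      rw [inst] at hm
      refine (ih hφ (snoc_over (t := Tm.obj x) hts hx)).2 hm ?_
      rw [snoc]
      exact h' _
  | ex φ ih =>
    have hφ' : (φ.subst ((Subst.fill ts).lift 1)).Over S :=
      (show φ.Over S from hφ).subst (Subst.Over.lift (Subst.over_fill hts) 1)
    refine ⟨fun h => ?_, fun h h' => ?_⟩
    · obtain ⟨x, hx, hm⟩ := hG.ex_left _ hφ' h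
      rw [inst] at hm
      refine ⟨cls (Tm.obj x), ?_⟩
      rw [← snoc]
      exact (ih hφ (snoc_over (t := Tm.obj x) hts hx)).1 hm
    · obtain ⟨a, ha⟩ := h'
      obtain ⟨t, ht, rfl⟩ := exists_over hd a
      have := hG.ex_right hφ' ht h
      rw [inst] at this
      rw [← snoc] at ha
      exact (ih hφ (snoc_over hts ht)).2 this ha

end Generic

end FOID
-- Definable sets as Henkin class, and minimality by (def L)
namespace FOID

open FirstOrder Language TmModel

variable {L : FirstOrder.Language.{u, v}} {Obj : Type w}

namespace TmModel

variable {S : Set (Sym L Obj)} {d : Obj} {A B : Set (Form L Obj 0)}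

/-- The subsets of the term model that are defined by a first-order formula. -/
def definable (R : Interp L (TmModel S d A B)) (k : ℕ) : Set (Set (Fin k → TmModel S d A B)) :=
  {X | ∃ F : Form L Obj k, X = {a | @Form.Holds L Obj _ (str R) val k R R F a}}

theorem realize_relabel_rep (hd : .inr (.inr d) ∈ S) (R : Interp L (TmModel S d A B)) {k : ℕ}
    (a : TmModel S d A B) (xs : Fin k → TmModel S d A B) :
    @Term.realize L _ (str R) _ (Sum.elim val xs)
      ((rep a).relabel (Sum.map id (Fin.elim0 : Fin 0 → Fin k))) = a := by
  let := str R
  rw [Term.realize_relabel]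
  have : Sum.elim val xs ∘ Sum.map id (Fin.elim0 : Fin 0 → Fin k) =
      Sum.elim val fun i => (cls ((Fin.elim0 : Fin 0 → Tm L Obj 0) i) : TmModel S d A B) := by
    funext x
    rcases x with o | i
    · rfl
    · exact i.elim0
  rw [this, realize_cls hd]
  exact (congrArg cls (Tm.subst_eq_self (σ := Subst.fill Fin.elim0) ⟨fun _ _ => rfl, fun i => i.elim0⟩)).trans (cls_rep a)

/-- Parameters from the domain are no obstacle, since every element is the value of a closed term,
which can be substituted for it in the defining formula. -/
theorem henkinClass_definable (hd : .inr (.inr d) ∈ S) (R : Interp L (TmModel S d A B)) :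
    let _ := str R
    HenkinClass L (definable R) := by
  intro _
  refine ⟨⟨.eq (.var (.inr 0)) (.var (.inr 1)), rfl⟩, fun P => ⟨.rel P fun i => .var (.inr i), rfl⟩,
    ?_, ?_, ?_, ?_, ?_⟩
  · rintro k _ a ⟨F, rfl⟩
    refine ⟨F.subst (Subst.fill (Fin.snoc (α := fun _ => Tm L Obj k) (fun i => .var (.inr i))
      ((rep a).relabel (Sum.map id Fin.elim0)))), ?_⟩
    ext x
    simp only [Set.mem_ofPred_eq, Form.holds_subst_fill]
    apply iff_of_eq
    congr 1
    funext i
    refine Fin.lastCases ?_ (fun j => ?_) i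
    · rw [Fin.snoc_last, Fin.snoc_last, realize_relabel_rep hd]
    · rw [Fin.snoc_castSucc, Fin.snoc_castSucc]
      rfl
  · rintro k m _ t ⟨F, rfl⟩
    refine ⟨F.subst (Subst.fill fun i => (t i).subst (Sum.elim
      (fun a => (rep a).relabel (Sum.map id Fin.elim0)) fun j => .var (.inr j))), ?_⟩
    ext x
    simp only [Set.mem_ofPred_eq, Form.holds_subst_fill]
    apply iff_of_eq
    congr 1
    funext i
    rw [Term.realize_subst]
    congr 1
    funext y
    rcases y with a | j
    · exact (realize_relabel_rep hd R a x).symm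
    · rfl
  · rintro k _ ⟨F, rfl⟩
    exact ⟨F.neg, rfl⟩
  · rintro k _ _ ⟨F, rfl⟩ ⟨G, rfl⟩
    exact ⟨F.and G, rfl⟩
  · rintro k _ ⟨F, rfl⟩
    exact ⟨F.all, rfl⟩

theorem realize_norm (hd : .inr (.inr d) ∈ S) (R : Interp L (TmModel S d A B)) {k : ℕ}
    (t : Tm L Obj k) (xs : Fin k → TmModel S d A B) :
    let _ := str R
    (Tm.norm S d t).realize (Sum.elim val xs) = t.realize (Sum.elim val xs) := by
  intro _
  have hd' : Tm.norm S d (Tm.obj d : Tm L Obj 0) = Tm.obj d := if_pos hd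
  induction t with
  | var x =>
    rcases x with o | i
    · rw [Tm.norm]
      split_ifs with h
      · rfl
      · refine cls_eq_of_norm_eq ?_
        rw [hd']
        exact (if_neg h).symm
    · rfl
  | func f ts ih =>
    rw [Tm.norm]
    split_ifs with h
    · simp only [Term.realize_func, ih]
    · refine cls_eq_of_norm_eq ?_
      rw [hd']
      exact (if_neg h).symm

/-- Definable sets may use symbols outside `S`, whereas the induction hypotheses available in (def
L) are over `S`. Normalisation bridges the gap: a term outside `S` has the same value as its normal
form, and a predicate outside `S` is empty. -/
theorem holds_norm (hd : .inr (.inr d) ∈ S) {R : Interp L (TmModel S d A B)}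
    (hR : ∀ P, .inr (.inl P) ∉ S → R P = ∅) {k : ℕ} (φ : Form L Obj k)
    (xs : Fin k → TmModel S d A B) :
    let _ := str R
    (φ.norm S d).Holds val R R xs ↔ φ.Holds val R R xs := by
  intro _
  induction φ with
  | top | bot => rfl
  | eq t s => simp only [Form.norm, Form.Holds, realize_norm hd R]
  | rel P ts =>
    rw [Form.norm]
    split_ifs with h
    · simp only [Form.Holds, realize_norm hd R]
    · simp only [Form.Holds, hR P h]
      rfl
  | neg φ ih => simp only [Form.norm, Form.Holds, ih]
  | and φ ψ ih₁ ih₂ | or φ ψ ih₁ ih₂ | imp φ ψ ih₁ ih₂ | iff φ ψ ih₁ ih₂ =>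
    simp only [Form.norm, Form.Holds, ih₁, ih₂]
  | all φ ih | ex φ ih => simp only [Form.norm, Form.Holds, ih]

end TmModel

namespace Generic

variable [DecidableEq Obj] [Infinite Obj] {n : ℕ} {S : Set (Sym L Obj)} {d : Obj}
  {Φ : Fin n → Defn L Obj 0} {A B : Set (Form L Obj 0)}

theorem henkinModel (hG : Generic S Φ A B) (hd : .inr (.inr d) ∈ S)
    (hlit : ∀ i, ∀ r ∈ (Φ i).rules, r.body.IsLitComb)
    (hneg : ∀ i, ∀ r ∈ (Φ i).rules, r.body.NegFree) (hover : ∀ i, ∀ r ∈ (Φ i).rules, r.Over S)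
    (hdisj : ∀ i j, i ≠ j → Disjoint (Φ i).defined (Φ j).defined) (i : Fin n) :
    let I : Interp L (TmModel S d A B) := preds Φ
    let _ := str I
    (Φ i).HenkinModel (definable I) val Fin.elim0 := by
  intro I _
  have hI : Closed Φ I := preds_closed hlit hneg
  refine ⟨⟨fun _ _ => rfl, fun P _ => ⟨(henkinClass_definable hd I).pred P, hI.step_le i P⟩⟩, ?_⟩
  rintro J ⟨hJ, hJd⟩
  choose F hF using fun Q : (Φ i).defined => (hJd Q.1 Q.2).1
  have hFn (Q : (Φ i).defined) (a) : a ∈ J Q.1 ↔ ((F Q).norm S d).Holds val I I a := by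
    refine Iff.trans ?_ (holds_norm hd (fun P hP => ?_) _ _).symm
    · rw [hF Q]
      rfl
    -- Below `avoid`, every predicate outside `S` is empty.
    · exact Set.eq_empty_of_forall_notMem fun a ha =>
        hP (preds_le (hG.avoid_closed hd hlit hneg hover) P ha).1
  let G := (Φ i).extend fun Q => (F Q).norm S d
  have hGJ {Q : Pred L} (hQ : Q ∈ (Φ i).defined) (a) : a ∈ J Q ↔ (G Q).Holds val I I a := by
    rw [hFn ⟨Q, hQ⟩, show G Q = _ from (Φ i).extend_of_mem _ hQ]
  have hGover (Q : Pred L) : (G Q).Over S := by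
    by_cases hQ : Q ∈ (Φ i).defined
    · rw [show G Q = _ from (Φ i).extend_of_mem _ hQ]
      exact Form.over_norm hd _
    · rw [show G Q = .bot from dif_neg hQ]
      trivial
  -- The meet with `I` is needed for the other definitions: their bodies may mention predicates of
  -- `Φ i`, so larger values in `J` could force tuples that `J`, equal to `I` outside `Φ i`, lacks.
  have hclosed : Closed Φ (J ⊓ I) := by
    refine ⟨fun P ts hP hm => ⟨?_, hI.base P ts hP hm⟩, fun j P a ha => ?_⟩
    · by_cases hPd : P ∈ (Φ i).defined
      · rcases hG.defn_left i P hPd ts hP.2 (fun Q => (F Q).norm S d)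
          (fun Q => Form.over_norm hd _) hm with h | ⟨r, hr, s, hs, h₁, h₂⟩
        · exact (hGJ hPd _).2 ((hG.truth hd hlit hneg hover (hGover P) hP.2).1 h)
        · exfalso
          obtain ⟨-, hargs, hbody⟩ := hover i r hr
          have hrd : r.head ∈ (Φ i).defined := ⟨r, hr, rfl⟩
          -- The hypothesis for the head is in `B`, hence false. But the substituted body is in `A`,
          -- hence true, so the rule body holds in `J`, and the closure of `J` makes the same
          -- hypothesis true.
          refine (hG.truth hd hlit hneg hover (hGover r.head)
            fun l => (hargs l).subst (Subst.over_fill hs)).2 h₂ ((hGJ hrd _).1 ?_)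
          refine (hJd _ hrd).2 ⟨r, hr, fun l => cls (s (Fin.natAdd 0 l)), ?_, ?_⟩
          · rw [append_elim0_natAdd fun l => cls (s l)]
            simp only [realize_cls hd]
          · rw [append_elim0_natAdd fun l => cls (s l)]
            exact (hlit i r hr).holds_of_replace (hneg i r hr)
              (fun P hP a h => (hGJ hP a).2 h) (fun P hP => (hJ P hP).ge) _
              ((hG.truth hd hlit hneg hover (hbody.replace _ hGover true) hs).1 h₁)
      · rw [hJ P hPd]
        exact hI.base P ts hP hm
    · rw [step_str _ I] at ha
      have haI : a ∈ I P := hI.step_le j P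
        (Defn.step_mono (hlit j) (hneg j) _ _ inf_le_right _ _ P ha)
      refine ⟨?_, haI⟩
      by_cases hPd : P ∈ (Φ i).defined
      · have hPj : P ∈ (Φ j).defined := by
          obtain ⟨r, hr, b, h, -⟩ := ha
          exact ⟨r, hr, (Sigma.mk.inj_iff.1 h).1.symm⟩
        -- A predicate of `Φ i` is the head of a rule of `Φ j` only if the definitions coincide, so
        -- closure of `J` under `Φ i` alone is enough.
        obtain rfl : i = j := by
          by_contra h
          exact Set.disjoint_left.1 (hdisj i j h) hPd hPj
        exact (hJd P hPd).2 (Defn.step_mono (hlit i) (hneg i) _ _ inf_le_left _ _ P ha)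
      · rw [hJ P hPd]
        exact haI
  exact (preds_le hclosed).trans inf_le_left

end Generic

/-- The language may be uncountable, but a sequent has finitely many symbols. Countability of `S` is
what the generic construction needs; the infinite supply of object symbols serves as eigenvariables.
-/
theorem exists_countable_over {n : ℕ} [Infinite Obj] {Γ Δ : Set (Form L Obj 0)} (hΓ : Γ.Finite)
    (hΔ : Δ.Finite) (Φ : Fin n → Defn L Obj 0) :
    ∃ S : Set (Sym L Obj), S.Countable ∧ {x : Obj | .inr (.inr x) ∈ S}.Infinite ∧
      (∀ φ ∈ Γ ∪ Δ, φ.Over S) ∧ ∀ i, ∀ r ∈ (Φ i).rules, r.Over S := by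
  choose T hT hTo using fun φ : Form L Obj 0 => φ.exists_over
  choose U hU hUo using fun r : Rule L Obj 0 => r.exists_over
  refine ⟨(⋃ φ ∈ Γ ∪ Δ, T φ) ∪ (⋃ i, ⋃ r ∈ (Φ i).rules, U r) ∪
    Set.range fun m => .inr (.inr (Infinite.natEmbedding Obj m)), ?_, ?_, fun φ hφ => ?_,
    fun i r hr => ?_⟩
  · exact (((hΓ.union hΔ).countable.biUnion fun φ _ => (hT φ).countable).union
      (Set.countable_iUnion fun i => (Φ i).finite.countable.biUnion fun r _ =>
        (hU r).countable)).union (Set.countable_range _)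
  · refine (Set.infinite_range_of_injective (Infinite.natEmbedding Obj).injective).mono ?_
    rintro _ ⟨m, rfl⟩
    exact Or.inr ⟨m, rfl⟩
  · refine (hTo φ).mono ?_
    exact fun x hx => Or.inl (Or.inl (Set.mem_biUnion hφ hx))
  · refine (hUo r).mono ?_
    exact fun x hx => Or.inl (Or.inr (Set.mem_iUnion.2 ⟨i, Set.mem_biUnion hr hx⟩))

end FOID

open FOID TmModel in
theorem mainTheorem5 {L : FirstOrder.Language.{u, v}} {Obj : Type w} [DecidableEq Obj]
    [Infinite Obj] {n : ℕ} (Γ : Set (FOID.Form L Obj 0)) (Φ : Fin n → FOID.Defn L Obj 0)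
    (Δ : Set (FOID.Form L Obj 0))
    (hcan : FOID.Canonical Γ Φ Δ)
    (hneg : ∀ i, ∀ r ∈ (Φ i).rules, r.body.NegFree)
    (hvalid : FOID.HenkinValid (FOID.antecedent Γ Φ) (FOID.succedent Δ)) :
    FOID.CutFreeProvable (FOID.antecedent Γ Φ) (FOID.succedent Δ) := by
  by_contra hprv
  obtain ⟨S, hS, hSinf, hform, hover⟩ := exists_countable_over hcan.finite_left hcan.finite_right Φ
  obtain ⟨A, B, hA, hB, hG⟩ :=
    exists_generic hS hSinf hcan.finite_left hcan.finite_right (Φ := Φ) hprv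
  obtain ⟨d, hd⟩ := hSinf.nonempty
  let I : Interp L (TmModel S d A B) := preds Φ
  let := str I
  -- The truth lemma is specialised to formulas without open places, where the substitution of the
  -- empty tuple is trivial.
  have truth {φ : Form L Obj 0} (hφ : φ.Over S) := hG.truth hd hcan.body hneg hover hφ
    (ts := Fin.elim0) fun i => i.elim0
  have fill (φ : Form L Obj 0) : φ.subst (Subst.fill Fin.elim0) = φ :=
    Form.subst_eq_self ⟨fun _ _ => rfl, fun i => i.elim0⟩
  have elim0 : (fun i => cls ((Fin.elim0 : Fin 0 → Tm L Obj 0) i)) =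
      (Fin.elim0 : Fin 0 → TmModel S d A B) := funext fun i => i.elim0
  simp only [fill, elim0] at truth
  obtain ⟨_, ⟨φ, hφ, rfl⟩, hsat⟩ := hvalid (TmModel S d A B) val (definable I)
    (henkinClass_definable hd I) (by
      rintro _ (⟨φ, hφ, rfl⟩ | ⟨i, rfl⟩)
      · exact (Form.sat_toID _ _ _ _).2 ((truth (hform φ (Or.inl hφ))).1 (hA hφ))
      · exact hG.henkinModel hd hcan.body hneg hover hcan.disjoint i)
  exact (truth (hform φ (Or.inr hφ))).2 (hB hφ) ((Form.sat_toID _ _ _ _).1 hsat)
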